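/- Let $M$ be an oriented 3-manifold with exactly one cusp, whose boundary is a torus, with an oriented ideal triangulation $\mathcal T$ with tetrahedra $\Delta_1,\dots,\Delta_N$ and edges $e_1,\dots,e_N$. Let $z_1,\dots,z_N\in\mathbb C\setminus\{0,1\}$ be shape parameters satisfying the gluing equations $\prod_j z_j^{G_{ij}}(z_j')^{G'_{ij}}(z_j'')^{G''_{ij}}=1$ of all edges and the completeness equations $\prod_j z_j^{C_{\gamma j}}(z_j')^{C'_{\gamma j}}(z_j'')^{C''_{\gamma j}}=1$ of all peripheral curves $\gamma$ (for instance the shapes of the complete hyperbolic structure), where $z'=1/(1-z)$, $z''=1-1/z$, where $G^\square_{ij}$ ($\square$ ranging over the three quad types) is the number of edges of $\Delta_j$ with parameter $z_j^\square$ that are incident to $e_i$, and where $C^\square_{\gamma j}$ is the signed number of corners of $\Delta_j$ with parameter $z_j^\square$ cut off by $\gamma$. Put $\zeta=1/z$, $\zeta'=1/(1-z)$, $\zeta''=1/(z(z-1))$. A combinatorial flattening of $\mathcal T$ is a triple $(f,f',f'')$ of vectors in $\mathbb Z^N$ with $Gf+G'f'+G''f''=(2,\dots,2)^T$, $f+f'+f''=(1,\dots,1)^T$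 and $C_\gamma f+C_\gamma' f'+C_\gamma''f''=0$ for every peripheral curve $\gamma$. The 1-loop invariant with respect to a peripheral curve $\gamma$ is $$\tau^{\mathrm{CS}}_\gamma(\mathcal T)=\frac{\det\left(\sum_\square \widehat G^\square\,\mathrm{diag}(\zeta^\square)\right)}{2\prod_j\zeta_j^{f_j}(\zeta_j')^{f_j'}(\zeta_j'')^{f_j''}}\in\mathbb C/\{\pm1\},$$ where $\widehat G^\square$ is $G^\square$ with one row replaced by $C_\gamma^\square$. Let $\alpha:\pi_1(M)\to\mathbb Z$ be an epimorphism and $\mu$ a peripheral curve with $\alpha(\mu)=1$. For $n\ge1$ let $\mathcal T^{(n)}$ be the induced triangulation, with the pulled back shapes, of the $n$-fold cyclic cover $M^{(n)}$ corresponding to $\alpha^{-1}(n\mathbb Z)$; the curve $\mu$ on $M^{(n)}$ is the lift of $\mu^n$, i.e. the preimage of $\mu$. Choose lifts $\widetilde e_i$, $\widetilde\Delta_j$ of the edges and tetrahedra to the infinite cyclic cover, let $G^\square(t)=\sum_{k\in\mathbb Z}G_k^\square t^k$, where $(G_k^\square)_{ij}$ is the number of edges of $\mu^k\cdot\widetilde\Delta_j$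 with parameter $z_j^\square$ that are incident to $\widetilde e_i$, and define the twisted 1-loop invariant $$\tau^{\mathrm{CS}}(\mathcal T,t)=\frac{\det\left(\sum_\square G^\square(t)\,\mathrm{diag}(\zeta^\square)\right)}{\prod_j\zeta_j^{f_j}(\zeta_j')^{f_j'}(\zeta_j'')^{f_j''}}\in\mathbb C[t^{\pm1}]/(\pm t^{\mathbb Z}).$$ Then, for all $n\ge1$ and for all choices of orderings, lifts, replaced rows and combinatorial flattenings of $\mathcal T$ and of $\mathcal T^{(n)}$ in these definitions, up to sign $$\tau^{\mathrm{CS}}_\mu(\mathcal T^{(n)})=\tau^{\mathrm{CS}}_\mu(\mathcal T)\prod_{\omega^n=1,\ \omega\ne1}\tau^{\mathrm{CS}}(\mathcal T,\omega),$$ and hence, if $\tau^{\mathrm{CS}}_\mu(\mathcal T)\neq0$, up to sign $$\frac{\tau^{\mathrm{CS}}_\mu(\mathcal T^{(n)})}{\tau^{\mathrm{CS}}_\mu(\mathcal T)}=\prod_{\omega^n=1,\ \omega\ne1}\tau^{\mathrm{CS}}(\mathcal T,\omega).$$ -/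

import Mathlib

/-! ## Oriented ideal triangulations -/

/-- An edge of the standard tetrahedron with vertices `0, 1, 2, 3`. -/
abbrev TetEdge : Type := {s : Finset (Fin 4) // s.card = 2}

namespace TetEdge

/-- The image of an edge of the tetrahedron under a permutation of the vertices. -/
def map (σ : Equiv.Perm (Fin 4)) (s : TetEdge) : TetEdge :=
  ⟨s.1.map σ.toEmbedding, by rw [Finset.card_map]; exact s.2⟩

/-- The edge with the two end points `σ 0` and `σ 3`. -/
def ofPerm (σ : Equiv.Perm (Fin 4)) : TetEdge :=
  ⟨{σ 0, σ 3}, Finset.card_pair (σ.injective.ne (by decide))⟩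

/-- The three quad types (pairs of opposite edges) of the standard tetrahedron. The edges in quad
`0`, `1`, `2` carry the parameter `z`, `z'`, `z''` respectively; around each vertex the three
parameters then appear in the same cyclic order. -/
def quad : Fin 3 → Finset TetEdge :=
  ![{⟨{0, 1}, by decide⟩, ⟨{2, 3}, by decide⟩},
    {⟨{0, 2}, by decide⟩, ⟨{1, 3}, by decide⟩},
    {⟨{0, 3}, by decide⟩, ⟨{1, 2}, by decide⟩}]

end TetEdge

/-- An oriented ideal triangulation with set of tetrahedra `ι`: the face of the tetrahedron `i`
opposite to its vertex `v` is glued to the face of `nbr i v` opposite to the vertex `glue i v v`,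
and a vertex `w ≠ v` of that face is glued to the vertex `glue i v w`. The vertex orders of the
tetrahedra are compatible with the orientation, so that all `glue i v` are odd. No face is glued
to itself. -/
structure IdealTriangulation (ι : Type*) where
  nbr : ι → Fin 4 → ι
  glue : ι → Fin 4 → Equiv.Perm (Fin 4)
  nbr_nbr : ∀ i v, nbr (nbr i v) (glue i v v) = i
  glue_glue : ∀ i v, glue (nbr i v) (glue i v v) = (glue i v)⁻¹
  glue_odd : ∀ i v, Equiv.Perm.sign (glue i v) = -1
  no_fold : ∀ i v, ¬ (nbr i v = i ∧ glue i v v = v)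

namespace IdealTriangulation

section Basic

variable {ι : Type*} (T : IdealTriangulation ι)

/-- Two edges of tetrahedra are identified by a face-pairing. -/
inductive EdgeRel : ι × TetEdge → ι × TetEdge → Prop
  | glue (i : ι) (v : Fin 4) (s : TetEdge) (h : v ∉ s.1) :
      EdgeRel (i, s) (T.nbr i v, s.map (T.glue i v))

/-- The edges of the triangulation: edges of tetrahedra modulo the equivalence relation
generated by the face-pairings. -/
def Edge : Type _ := Quot T.EdgeRel

/-- Two ideal vertices of tetrahedra are identified by a face-pairing. The pairs `(i, v)` are also
the triangles of the induced triangulation of the boundary. -/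
inductive CuspRel : ι × Fin 4 → ι × Fin 4 → Prop
  | glue (i : ι) (v w : Fin 4) (h : w ≠ v) : CuspRel (i, w) (T.nbr i v, T.glue i v w)

/-- The cusps, i.e. the boundary components. -/
def Cusp : Type _ := Quot T.CuspRel

/-- The triangulated manifold is connected and has exactly one cusp, whose link is a torus. The
link of the cusp is a closed connected oriented surface with Euler characteristic twice the number
of edges minus twice the number of tetrahedra. -/
structure IsOneCusped : Prop where
  nonempty : Nonempty T.Cusp
  subsingleton : Subsingleton T.Cusp
  finite : Finite ι
  euler : Nat.card T.Edge = Nat.card ι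

open Classical in
/-- The entry of the gluing equation matrix `G`, `G'`, `G''` (for `q = 0, 1, 2`) in the row of the
edge `e` and the column of the tetrahedron `j`: the number of edges of `j` with parameter
of type `q` that are incident to `e`. -/
noncomputable def gluing (q : Fin 3) (e : T.Edge) (j : ι) : ℕ :=
  ((TetEdge.quad q).filter fun s => (Quot.mk _ (j, s) : T.Edge) = e).card

/-! ## Normal curves in the boundary

A pair `(i, π)` of a tetrahedron and a permutation stands for an arc in the boundary triangle at
the vertex `π 0` of `i`, which enters through the side in the face opposite to `π 1`, leaves
through the side in the face opposite to `π 2`, and so cuts off the corner of the triangle on the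
edge of `i` from `π 0` to `π 3`. The corner lies on the left or on the right of the arc
according to the sign of `π`. -/

/-- The arc `y` starts where the arc `x` ends. -/
def Follows (x y : ι × Equiv.Perm (Fin 4)) : Prop :=
  y.1 = T.nbr x.1 (x.2 2) ∧ y.2 0 = T.glue x.1 (x.2 2) (x.2 0) ∧
    y.2 1 = T.glue x.1 (x.2 2) (x.2 2)

/-- The arc that follows `x` and cuts off the corner at the same vertex of the boundary
triangulation. Its iterates turn around an edge of the triangulation. -/
def rotate (x : ι × Equiv.Perm (Fin 4)) : ι × Equiv.Perm (Fin 4) :=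
  (T.nbr x.1 (x.2 2), T.glue x.1 (x.2 2) * x.2 * Equiv.swap 1 2)

/-- An oriented closed normal curve in the boundary: a closed sequence of arcs,
indexed periodically. -/
structure NormalLoop where
  len : ℕ
  len_pos : 0 < len
  arc : ℕ → ι × Equiv.Perm (Fin 4)
  periodic : ∀ k, arc (k + len) = arc k
  follows : ∀ k, T.Follows (arc k) (arc (k + 1))

/-- An integral 1-cocycle on the dual 2-complex of the triangulation, i.e. a homomorphism
from the fundamental group to `ℤ` together with a choice of lifts of the tetrahedra to the
corresponding cover. `val i v` is the value on the face-pairing from `i` across the face opposite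
to `v`, and the sum of the values around each edge vanishes. -/
structure Cocycle where
  val : ι → Fin 4 → ℤ
  antisymm : ∀ i v, val (T.nbr i v) (T.glue i v v) = - val i v
  closed : ∀ (x : ι × Equiv.Perm (Fin 4)) (m : ℕ), T.rotate^[m] x = x →
    ∑ k ∈ Finset.range m, val (T.rotate^[k] x).1 ((T.rotate^[k] x).2 2) = 0

/-- An integral 1-cocycle on the dual 2-complex of the boundary triangulation: `val i v w` is the
value on crossing, from the triangle at the vertex `v` of `i`, the side in the face opposite
to `w ≠ v`. -/
structure BoundaryCocycle where
  val : ι → Fin 4 → Fin 4 → ℤ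
  antisymm : ∀ i v w, v ≠ w →
    val (T.nbr i w) (T.glue i w v) (T.glue i w w) = - val i v w
  closed : ∀ (x : ι × Equiv.Perm (Fin 4)) (m : ℕ), T.rotate^[m] x = x →
    ∑ k ∈ Finset.range m,
      val (T.rotate^[k] x).1 ((T.rotate^[k] x).2 0) ((T.rotate^[k] x).2 2) = 0

variable {T}

/-- The value of the homomorphism `α` on a closed curve in the boundary. -/
def Cocycle.eval (α : T.Cocycle) (γ : T.NormalLoop) : ℤ :=
  ∑ k ∈ Finset.range γ.len, α.val (γ.arc k).1 ((γ.arc k).2 2)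

/-- The value of a boundary cocycle on a closed curve in the boundary. -/
def BoundaryCocycle.eval (β : T.BoundaryCocycle) (γ : T.NormalLoop) : ℤ :=
  ∑ k ∈ Finset.range γ.len, β.val (γ.arc k).1 ((γ.arc k).2 0) ((γ.arc k).2 2)

namespace NormalLoop

variable (γ : T.NormalLoop)

/-- Given the distances `p k` and `q k` of the entry point and the exit point of the `k`-th arc
from the corner cut off by this arc (along sides of length `1`), the distance of the end point of
the `k`-th arc on the side `s` from that corner. -/
def endDist (p q : ℕ → ℝ) (k : ℕ) (s : Fin 4) : ℝ :=
  if s = (γ.arc k).2 1 then p k else q k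

/-- The `k`-th and the `l`-th arc do not cross, if they lie in the same triangle: if they cut
off the same corner, one of them is closer to it on both sides; otherwise, on the side that they
both meet (which joins the two corners), each is closer to its own corner. -/
def ArcsDisjoint (p q : ℕ → ℝ) (k l : ℕ) : Prop :=
  (γ.arc k).1 = (γ.arc l).1 → (γ.arc k).2 0 = (γ.arc l).2 0 →
    ((γ.arc k).2 3 = (γ.arc l).2 3 →
      (∀ s, s ≠ (γ.arc k).2 0 → s ≠ (γ.arc k).2 3 →
          γ.endDist p q k s < γ.endDist p q l s) ∨
        (∀ s, s ≠ (γ.arc k).2 0 → s ≠ (γ.arc k).2 3 →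
          γ.endDist p q l s < γ.endDist p q k s)) ∧
    ((γ.arc k).2 3 ≠ (γ.arc l).2 3 →
      ∀ s, s ≠ (γ.arc k).2 0 → s ≠ (γ.arc k).2 3 → s ≠ (γ.arc l).2 3 →
        γ.endDist p q k s + γ.endDist p q l s < 1)

/-- A normal curve is simple if it can be realized by pairwise disjoint arcs. -/
def IsSimple : Prop :=
  ∃ p q : ℕ → ℝ,
    (∀ k, p (k + γ.len) = p k ∧ q (k + γ.len) = q k) ∧
    (∀ k, 0 < p k ∧ p k < 1 ∧ 0 < q k ∧ q k < 1) ∧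
    (∀ k, p (k + 1) =
      if (γ.arc (k + 1)).2 3 = T.glue (γ.arc k).1 ((γ.arc k).2 2) ((γ.arc k).2 3)
        then q k else 1 - q k) ∧
    ∀ k l, k < γ.len → l < γ.len → k ≠ l → γ.ArcsDisjoint p q k l

/-- A closed curve on the boundary torus is homotopically non-trivial. As the fundamental group of
a torus is free abelian, this is detected by integral first cohomology. -/
def IsEssential : Prop := ∃ β : T.BoundaryCocycle, β.eval γ ≠ 0

/-- A peripheral curve: an oriented, homotopically non-trivial, simple closed curve in the
boundary torus. -/
def IsPeripheral : Prop := γ.IsSimple ∧ γ.IsEssential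

open Classical in
/-- The entry of the row vector `C`, `C'`, `C''` (for `q = 0, 1, 2`) of the completeness equation
of `γ` in the column of the tetrahedron `j`: corners with parameter of type `q` are counted with
a sign for the side of `γ` on which they lie. -/
noncomputable def coeff (q : Fin 3) (j : ι) : ℤ :=
  ∑ k ∈ Finset.range γ.len,
    if (γ.arc k).1 = j ∧ TetEdge.ofPerm (γ.arc k).2 ∈ TetEdge.quad q then
      ((Equiv.Perm.sign (γ.arc k).2 : ℤˣ) : ℤ) else 0

end NormalLoop

end Basic

/-! ## Cyclic covers -/

section Cover

variable {ι : Type*} {T : IdealTriangulation ι}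

/-- The induced ideal triangulation of the cover given by the homomorphism `α` modulo `n` (for
`Γ = ZMod n`) or by `α` itself (for `Γ = ℤ`). The tetrahedron `(i, k)` is the translate of the
chosen lift of `i` by the `k`-th power of the generator of the deck group. -/
def cover (α : T.Cocycle) (Γ : Type*) [Ring Γ] : IdealTriangulation (ι × Γ) where
  nbr x v := (T.nbr x.1 v, x.2 + (α.val x.1 v : Γ))
  glue x v := T.glue x.1 v
  nbr_nbr x v := by simp [T.nbr_nbr, α.antisymm]
  glue_glue x v := T.glue_glue x.1 v
  glue_odd x v := T.glue_odd x.1 v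
  no_fold x v h := T.no_fold x.1 v ⟨congrArg Prod.fst h.1, h.2⟩

/-- The covering projection on edges. -/
def coverProj (α : T.Cocycle) (Γ : Type*) [Ring Γ] : (cover α Γ).Edge → T.Edge :=
  Quot.map (fun x => (x.1.1, x.2)) (by
    rintro _ _ ⟨i, v, s, h⟩
    exact EdgeRel.glue i.1 v s h)

/-- The sheet reached after the first `k` arcs of `γ`. -/
def NormalLoop.sheet (γ : T.NormalLoop) (α : T.Cocycle) (k : ℕ) : ℤ :=
  ∑ l ∈ Finset.range k, α.val (γ.arc l).1 ((γ.arc l).2 2)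

theorem NormalLoop.arc_add_mul (γ : T.NormalLoop) (m k : ℕ) :
    γ.arc (k + m * γ.len) = γ.arc k := by
  induction m with
  | zero => simp
  | succ m ih => rw [Nat.succ_mul, ← Nat.add_assoc, γ.periodic, ih]

theorem NormalLoop.sheet_add_len (γ : T.NormalLoop) (α : T.Cocycle) (k : ℕ) :
    γ.sheet α (k + γ.len) = γ.sheet α k + α.eval γ := by
  induction k with
  | zero => simp [NormalLoop.sheet, Cocycle.eval]
  | succ k ih =>
    have h1 : γ.sheet α (k + 1 + γ.len) = γ.sheet α (k + γ.len) +
        α.val (γ.arc k).1 ((γ.arc k).2 2) := by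
      rw [Nat.add_right_comm, NormalLoop.sheet, Finset.sum_range_succ, γ.periodic]; rfl
    have h2 : γ.sheet α (k + 1) = γ.sheet α k + α.val (γ.arc k).1 ((γ.arc k).2 2) := by
      rw [NormalLoop.sheet, Finset.sum_range_succ]; rfl
    rw [h1, h2, ih]; ring

theorem NormalLoop.sheet_add_mul (γ : T.NormalLoop) (α : T.Cocycle) (m k : ℕ) :
    γ.sheet α (k + m * γ.len) = γ.sheet α k + m * α.eval γ := by
  induction m with
  | zero => simp
  | succ m ih =>
    rw [Nat.succ_mul, ← Nat.add_assoc, γ.sheet_add_len, ih]; push_cast; ring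

/-- The lift to the `n`-fold cyclic cover of the curve `γ` traversed `n` times. If `α γ = 1`, this
is the curve whose image in the base covers `γ` exactly `n` times, i.e. the full preimage of `γ`. -/
def NormalLoop.liftPow (γ : T.NormalLoop) (α : T.Cocycle) (n : ℕ) [NeZero n] :
    (cover α (ZMod n)).NormalLoop where
  len := n * γ.len
  len_pos := Nat.mul_pos (Nat.pos_of_ne_zero (NeZero.ne n)) γ.len_pos
  arc k := (((γ.arc k).1, ((γ.sheet α k : ℤ) : ZMod n)), (γ.arc k).2)
  periodic k := by simp [γ.arc_add_mul, γ.sheet_add_mul]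
  follows k := by
    obtain ⟨h1, h2, h3⟩ := γ.follows k
    refine ⟨Prod.ext h1 ?_, h2, h3⟩
    simp [cover, NormalLoop.sheet, Finset.sum_range_succ]

end Cover

/-! ## Shapes, flattenings and the 1-loop invariants -/

/-- The three edge parameters `z`, `z' = 1 / (1 - z)`, `z'' = 1 - 1 / z`. -/
noncomputable def shape (z : ℂ) : Fin 3 → ℂ := ![z, 1 / (1 - z), 1 - 1 / z]

/-- The logarithmic derivatives `ζ`, `ζ'`, `ζ''` of the three edge parameters. -/
noncomputable def zeta (z : ℂ) : Fin 3 → ℂ := ![1 / z, 1 / (1 - z), 1 / (z * (z - 1))]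

section Invariants

variable {ι : Type*} [Fintype ι] [DecidableEq ι] (T : IdealTriangulation ι)

/-- The shapes `z` are non-degenerate and satisfy the gluing equation of each edge and
the completeness equation of each peripheral curve. -/
structure IsCompleteShape (z : ι → ℂ) : Prop where
  ne_zero : ∀ j, z j ≠ 0
  ne_one : ∀ j, z j ≠ 1
  edge : ∀ e : T.Edge, ∏ j, ∏ q, shape (z j) q ^ T.gluing q e j = 1
  cusp : ∀ γ : T.NormalLoop, γ.IsPeripheral → ∏ j, ∏ q, shape (z j) q ^ γ.coeff q j = 1

/-- A combinatorial flattening; `f 0`, `f 1`, `f 2` are the vectors `f`, `f'`, `f''`. -/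
structure IsFlattening (f : Fin 3 → ι → ℤ) : Prop where
  edge : ∀ e : T.Edge, ∑ q, ∑ j, (T.gluing q e j : ℤ) * f q j = 2
  tet : ∀ j, ∑ q, f q j = 1
  cusp : ∀ γ : T.NormalLoop, γ.IsPeripheral → ∑ q, ∑ j, γ.coeff q j * f q j = 0

/-- The product of all `ζ ^ f`, `ζ' ^ f'`, `ζ'' ^ f''`. -/
noncomputable def flatteningFactor (z : ι → ℂ) (f : Fin 3 → ι → ℤ) : ℂ :=
  ∏ j, ∏ q, zeta (z j) q ^ f q j

/-- The matrix `G diag(ζ) + G' diag(ζ') + G'' diag(ζ'')` with the row number `r` replaced by the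
corresponding row of the curve `γ`. The bijection `e` is an ordering of the edges. -/
noncomputable def hatMatrix (z : ι → ℂ) (e : ι ≃ T.Edge) (r : ι) (γ : T.NormalLoop) :
    Matrix ι ι ℂ :=
  (Matrix.of fun i j => ∑ q, (T.gluing q (e i) j : ℂ) * zeta (z j) q).updateRow r
    fun j => ∑ q, (γ.coeff q j : ℂ) * zeta (z j) q

/-- `x` represents the 1-loop invariant of `T` (an element of `ℂ` modulo sign) with respect to the
shapes `z` and the curve `γ`: it is given by the defining formula for some ordering of
the edges, some row to be replaced and some combinatorial flattening. -/
def IsOneLoop (z : ι → ℂ) (γ : T.NormalLoop) (x : ℂ) : Prop :=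
  ∃ (e : ι ≃ T.Edge) (r : ι) (f : Fin 3 → ι → ℤ), T.IsFlattening f ∧
    x = (T.hatMatrix z e r γ).det / (2 * flatteningFactor z f)

variable {T}

/-- The entry of the twisted gluing equation matrix `G(t)`, `G'(t)`, `G''(t)` (for `q = 0, 1, 2`)
in the row of a lift `e` of an edge to the infinite cyclic cover and in the column `j`. Only
finitely many terms of the sum are non-zero. -/
noncomputable def twistedGluing (α : T.Cocycle) (q : Fin 3) (e : (cover α ℤ).Edge) (j : ι) :
    LaurentPolynomial ℂ :=
  ∑ᶠ k : ℤ, LaurentPolynomial.C ((cover α ℤ).gluing q e (j, k) : ℂ) * LaurentPolynomial.T k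

/-- The matrix `G(t) diag(ζ) + G'(t) diag(ζ') + G''(t) diag(ζ'')`, for given lifts `e` of
the edges. -/
noncomputable def twistedMatrix (α : T.Cocycle) (z : ι → ℂ) (e : ι → (cover α ℤ).Edge) :
    Matrix ι ι (LaurentPolynomial ℂ) :=
  Matrix.of fun i j => ∑ q, twistedGluing α q (e i) j * LaurentPolynomial.C (zeta (z j) q)

/-- `p` represents the twisted 1-loop invariant (a Laurent polynomial up to a factor `± t ^ m`): it
is given by the defining formula for some ordering `e₀` of the edges, some lifts `e` of
them and some combinatorial flattening. -/
def IsTwistedOneLoop (α : T.Cocycle) (z : ι → ℂ) (p : LaurentPolynomial ℂ) : Prop :=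
  ∃ (e₀ : ι ≃ T.Edge) (e : ι → (cover α ℤ).Edge) (f : Fin 3 → ι → ℤ),
    (∀ i, coverProj α ℤ (e i) = e₀ i) ∧ T.IsFlattening f ∧
    p = LaurentPolynomial.C (flatteningFactor z f)⁻¹ * (twistedMatrix α z e).det

end Invariants

end IdealTriangulation

/-!
Write `A` for the matrix `∑ G diag(ζ)` and `c` for the row `∑ C diag(ζ)` of the curve `μ`. There are
two things to compare, the determinants and the products over the flattenings.

*Determinants.* Each tetrahedron has two edges of each type and `ζ + ζ' + ζ'' = 0`, so the rows of
`A` add up to zero, and replacing one row by `c` is the same, up to the number of rows, as adding `c`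
to all rows (`Matrix.card_mul_det_updateRow`). The latter is compatible with the symmetry of the
cyclic cover: as the lift of the `n`-th power of `μ` passes once through every lift of each arc, the
matrix of the cover with its curve row added everywhere is block circulant, and the characters of
`ZMod n` decompose it (`Matrix.det_blockCirculant`). The trivial character gives the determinant of
the base, a non-trivial one the value of the twisted determinant at a root of unity
(`det_cover_eq_prod`).

*Flattenings.* The push forward of a flattening of the cover and a sum of `n` flattenings of the base
differ by an integral solution `h` of the homogeneous equations, and `∏ ζ ^ h = ± 1` has to be shown
(`flatteningFactor_sq_eq_one`). Everything rests on one local identity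
(`TetEdge.sign_mul_quadSum_sub`): for a weight `k` on the edges, the symplectic dual of the vector
`∑ k G`, evaluated at an arc in a boundary triangle, is the difference of two vertex weights
`k₀₁ + k₀₃ - k₁₃` that belong to the two faces which the arc meets. It has these consequences.

* The gluing and completeness equations are in involution. Moreover, if `k` is the height of the
  edges in the infinite cyclic cover, the dual of `k` is orthogonal to the gluing equations and pairs
  with the completeness equation of `μ` to `-α(μ) = -1`.
* If the dual of `∑ k G` vanishes, over any commutative ring, the vertex weights descend to the
  cusps, and since there is only one cusp, `2 k` is constant
  (`exists_two_mul_eq_of_quadSums_eq`).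

Over `ℚ`, counting dimensions gives that `h` is a combination of the duals of the equations
(`exists_rat_combination`). The coefficient at `μ` is integral, being a pairing with the heights,
and by the second point over `ZMod D`, where `D` is a common denominator, twice the remaining part is
an integral combination of duals of gluing equations. Hence `∏ ζ ^ h` is a square root of
`± 1`. The sign under the root is the parity of a number of edges of tetrahedra, which is even because
modulo 2 it counts faces of tetrahedra, and these are glued in pairs (`sum_edges_eq_zero`). Signs are
handled throughout by comparing squares.
-/

/-! ### The standard tetrahedron -/

namespace TetEdge

open Equiv (swap)

theorem ofPerm_mul (σ π : Equiv.Perm (Fin 4)) : ofPerm (σ * π) = map σ (ofPerm π) := by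
  apply Subtype.ext
  simp [ofPerm, map, Finset.map_insert]

theorem ofPerm_mul_swap_zero_three (π : Equiv.Perm (Fin 4)) :
    ofPerm (π * swap 0 3) = ofPerm π := by
  apply Subtype.ext
  simp [ofPerm, Finset.pair_comm]

theorem ofPerm_mul_swap_one_two (π : Equiv.Perm (Fin 4)) :
    ofPerm (π * swap 1 2) = ofPerm π := by
  revert π
  decide +kernel

theorem notMem_ofPerm_two (π : Equiv.Perm (Fin 4)) : π 2 ∉ (ofPerm π).1 := by
  simp [ofPerm]

/-- The quad type of an edge of the tetrahedron. -/
def quadOf (s : TetEdge) : Fin 3 :=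
  if s ∈ quad 0 then 0 else if s ∈ quad 1 then 1 else 2

theorem mem_quad_iff (q : Fin 3) (s : TetEdge) : s ∈ quad q ↔ quadOf s = q := by
  revert q s
  decide

theorem card_quad (q : Fin 3) : (quad q).card = 2 := by
  revert q
  decide

theorem card_filter_ofPerm (s : TetEdge) :
    (Finset.univ.filter fun π : Equiv.Perm (Fin 4) => ofPerm π = s).card = 4 := by
  revert s
  decide +kernel

/-- The four edges off the quad of `π 0` and `π 3`. -/
theorem quad_of_sign_one (π : Equiv.Perm (Fin 4)) (h : Equiv.Perm.sign π = 1) :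
    quad (quadOf (ofPerm π) + 1) = {ofPerm (π * swap 1 3), ofPerm (π * swap 0 2)} ∧
    quad (quadOf (ofPerm π) + 2) = {ofPerm (π * swap 2 3), ofPerm (π * swap 0 1)} ∧
    ofPerm (π * swap 1 3) ≠ ofPerm (π * swap 0 2) ∧
    ofPerm (π * swap 2 3) ≠ ofPerm (π * swap 0 1) := by
  revert π
  decide +kernel

theorem quad_of_sign_neg_one (π : Equiv.Perm (Fin 4)) (h : Equiv.Perm.sign π = -1) :
    quad (quadOf (ofPerm π) + 2) = {ofPerm (π * swap 1 3), ofPerm (π * swap 0 2)} ∧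
    quad (quadOf (ofPerm π) + 1) = {ofPerm (π * swap 2 3), ofPerm (π * swap 0 1)} ∧
    ofPerm (π * swap 1 3) ≠ ofPerm (π * swap 0 2) ∧
    ofPerm (π * swap 2 3) ≠ ofPerm (π * swap 0 1) := by
  revert π
  decide +kernel

theorem sum_ofPerm {R : Type*} [AddCommMonoid R] (F : TetEdge → R) :
    ∑ π : Equiv.Perm (Fin 4), F (ofPerm π) = 4 • ∑ s, F s := by
  rw [← Finset.sum_fiberwise_of_maps_to (g := ofPerm) (t := Finset.univ) (by simp),
    Finset.smul_sum]
  refine Finset.sum_congr rfl fun s _ => ?_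
  rw [Finset.sum_congr rfl (g := fun _ => F s) (by simp +contextual), Finset.sum_const,
    card_filter_ofPerm]

theorem sum_quad {R : Type*} [AddCommMonoid R] (F : Fin 3 → TetEdge → R) :
    ∑ q, ∑ s ∈ quad q, F q s = ∑ s, F (quadOf s) s := by
  rw [← Finset.sum_fiberwise_of_maps_to (s := Finset.univ) (g := quadOf) (t := Finset.univ)
    (by simp)]
  refine Finset.sum_congr rfl fun q _ => Finset.sum_congr ?_ fun s hs => ?_
  · ext s; simp [mem_quad_iff]
  · rw [(Finset.mem_filter.1 hs).2]

section Weights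

variable {R : Type*} [CommRing R] (k : TetEdge → R)

/-- The sum of a weight function on the edges over the two edges of a quad type. -/
def quadSum (q : Fin 3) : R := ∑ s ∈ quad q, k s

/-- For a weight function `k` on the edges, the number `k₀₁ + k₀₃ - k₁₃`, where the vertices are
renamed by `π`. If `k` were the sum of weights of the two end points, it would be twice
the weight of `π 0`. It only involves the face opposite to `π 2`. -/
def vertexWeight (π : Equiv.Perm (Fin 4)) : R :=
  k (ofPerm (π * swap 1 3)) + k (ofPerm π) - k (ofPerm (π * swap 0 1))

theorem vertexWeight_mul_swap_one_three (π : Equiv.Perm (Fin 4)) :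
    vertexWeight k (π * swap 1 3) = vertexWeight k π := by
  have h1 : π * swap 1 3 * swap 1 3 = π := by rw [mul_assoc, Equiv.swap_mul_self, mul_one]
  have h2 : ofPerm (π * swap 1 3 * swap 0 1) = ofPerm (π * swap 0 1) := by
    revert π; decide +kernel
  rw [vertexWeight, vertexWeight, h1, h2]
  ring

theorem vertexWeight_swap_one_two (π : Equiv.Perm (Fin 4)) :
    vertexWeight k (π * swap 1 2) = k (ofPerm (π * swap 2 3)) + k (ofPerm π)
      - k (ofPerm (π * swap 0 2)) := by
  have h1 : ofPerm (π * swap 1 2 * swap 1 3) = ofPerm (π * swap 2 3) := by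
    revert π; decide +kernel
  have h2 : ofPerm (π * swap 1 2 * swap 0 1) = ofPerm (π * swap 0 2) := by
    revert π; decide +kernel
  rw [vertexWeight, h1, h2, ofPerm_mul_swap_one_two]

theorem vertexWeight_add_vertexWeight (π : Equiv.Perm (Fin 4)) :
    vertexWeight k π + vertexWeight k (π * swap 0 3) = 2 * k (ofPerm π) := by
  have h1 : ofPerm (π * swap 0 3 * swap 1 3) = ofPerm (π * swap 0 1) := by
    revert π; decide +kernel
  have h2 : ofPerm (π * swap 0 3 * swap 0 1) = ofPerm (π * swap 1 3) := by
    revert π; decide +kernel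
  rw [vertexWeight, vertexWeight, h1, h2, ofPerm_mul_swap_zero_three]
  ring

/-- The symplectic dual of the quad sums of `k`, at the corner of an arc, is the difference of the
vertex weights in the two faces that the arc meets. -/
theorem sign_mul_quadSum_sub (π : Equiv.Perm (Fin 4)) :
    ((Equiv.Perm.sign π : ℤˣ) : ℤ) * (quadSum k (quadOf (ofPerm π) + 1)
      - quadSum k (quadOf (ofPerm π) + 2))
      = vertexWeight k π - vertexWeight k (π * swap 1 2) := by
  rw [vertexWeight_swap_one_two, vertexWeight, quadSum, quadSum]
  rcases Int.units_eq_one_or (Equiv.Perm.sign π) with h | h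
  · obtain ⟨h1, h2, h3, h4⟩ := quad_of_sign_one π h
    rw [h1, h2, Finset.sum_pair h3, Finset.sum_pair h4, h]
    push_cast
    ring
  · obtain ⟨h1, h2, h3, h4⟩ := quad_of_sign_neg_one π h
    rw [h1, h2, Finset.sum_pair h3, Finset.sum_pair h4, h]
    push_cast
    ring

/-- A function of permutations that is invariant under the permutations of `1, 2, 3` only depends on
the image of `0`. -/
theorem eq_of_apply_zero_eq {R : Type*} (f : Equiv.Perm (Fin 4) → R)
    (h12 : ∀ π, f (π * swap 1 2) = f π) (h13 : ∀ π, f (π * swap 1 3) = f π)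
    {π σ : Equiv.Perm (Fin 4)} (h : π 0 = σ 0) : f π = f σ := by
  have key : ∀ τ : Equiv.Perm (Fin 4), τ 0 = 0 → τ = 1 ∨ τ = swap 1 2 ∨ τ = swap 1 3 ∨
      τ = swap 1 2 * swap 1 3 ∨ τ = swap 1 3 * swap 1 2 ∨
      τ = swap 1 2 * swap 1 3 * swap 1 2 := by
    decide +kernel
  have hσ : σ = π * (π⁻¹ * σ) := by group
  rw [hσ]
  rcases key (π⁻¹ * σ) (by simp [← h]) with h | h | h | h | h | h <;> rw [h] <;>
    simp only [← mul_assoc, mul_one, h12, h13]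

end Weights

end TetEdge

/-! ### The symplectic form on shape assignments -/

namespace IdealTriangulation

open TetEdge Equiv

variable {ι : Type*}

section Symplectic

variable [Fintype ι] {R : Type*} [CommRing R]

/-- The antisymmetric form of Neumann and Zagier. -/
def symplecticForm (u v : Fin 3 → ι → R) : R :=
  ∑ q, ∑ j, u q j * (v (q + 1) j - v (q + 2) j)

theorem symplecticForm_antisymm (u v : Fin 3 → ι → R) :
    symplecticForm u v = -symplecticForm v u := by
  simp only [symplecticForm, Fin.sum_univ_three, ← Finset.sum_add_distrib,
    ← Finset.sum_neg_distrib]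
  refine Finset.sum_congr rfl fun j _ => ?_
  simp only [show (0 : Fin 3) + 1 = 1 from rfl, show (0 : Fin 3) + 2 = 2 from rfl,
    show (1 : Fin 3) + 1 = 2 from rfl, show (1 : Fin 3) + 2 = 0 from rfl,
    show (2 : Fin 3) + 1 = 0 from rfl, show (2 : Fin 3) + 2 = 1 from rfl]
  ring

theorem symplecticForm_self (u : Fin 3 → ι → R) : symplecticForm u u = 0 := by
  simp only [symplecticForm, Fin.sum_univ_three, ← Finset.sum_add_distrib]
  refine Finset.sum_eq_zero fun j _ => ?_
  simp only [show (0 : Fin 3) + 1 = 1 from rfl, show (0 : Fin 3) + 2 = 2 from rfl,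
    show (1 : Fin 3) + 1 = 2 from rfl, show (1 : Fin 3) + 2 = 0 from rfl,
    show (2 : Fin 3) + 1 = 0 from rfl, show (2 : Fin 3) + 2 = 1 from rfl]
  ring

end Symplectic

section Weights

variable (T : IdealTriangulation ι) {R : Type*} [CommRing R]

/-- The vectors of quad sums of a weight function on the edges of the tetrahedra. -/
def quadSums (k : ι × TetEdge → R) (q : Fin 3) (j : ι) : R := quadSum (fun s => k (j, s)) q

/-- The weight function `k` on the edges of the tetrahedra changes by `a i v` across the face of `i`
opposite to `v`. For `a = 0` it is a function on the edges of the triangulation; in general it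
describes heights of the edges of the tetrahedra in an infinite cyclic cover. -/
def HasJump (k : ι × TetEdge → R) (a : ι → Fin 4 → R) : Prop :=
  ∀ i v (s : TetEdge), v ∉ s.1 → k (T.nbr i v, s.map (T.glue i v)) = k (i, s) + a i v

/-- The edge of the triangulation that contains a given edge of a tetrahedron. -/
def edgeMk (x : ι × TetEdge) : T.Edge := Quot.mk _ x

theorem edgeMk_glue (i : ι) (v : Fin 4) (s : TetEdge) (h : v ∉ s.1) :
    T.edgeMk (T.nbr i v, s.map (T.glue i v)) = T.edgeMk (i, s) :=
  (Quot.sound (EdgeRel.glue i v s h)).symm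

theorem edgeMk_surjective : Function.Surjective T.edgeMk := Quot.mk_surjective

open Classical in
theorem gluing_eq_card (q : Fin 3) (e : T.Edge) (j : ι) :
    T.gluing q e j = ((quad q).filter fun s => T.edgeMk (j, s) = e).card := rfl

/-- The edge of the triangulation on which the corner at the arc `x` lies. -/
def arcEdge (x : ι × Perm (Fin 4)) : T.Edge := T.edgeMk (x.1, ofPerm x.2)

/-- The same corner seen from the other side of the face opposite to `x.2 2`. -/
def flip (x : ι × Perm (Fin 4)) : ι × Perm (Fin 4) :=
  (T.nbr x.1 (x.2 2), T.glue x.1 (x.2 2) * x.2)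

theorem flip_flip (x : ι × Perm (Fin 4)) : T.flip (T.flip x) = x := by
  simp only [flip, Perm.mul_apply, T.nbr_nbr, T.glue_glue, inv_mul_cancel_left]

/-- Turning around an edge is the composition of two involutions. -/
theorem rotate_eq (x : ι × Perm (Fin 4)) :
    T.rotate x = ((T.flip x).1, (T.flip x).2 * swap 1 2) := rfl

theorem arcEdge_flip (x : ι × Perm (Fin 4)) : T.arcEdge (T.flip x) = T.arcEdge x := by
  rw [arcEdge, arcEdge, flip, ofPerm_mul]
  exact T.edgeMk_glue x.1 _ _ (notMem_ofPerm_two _)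

theorem sign_flip (x : ι × Perm (Fin 4)) : Perm.sign (T.flip x).2 = -Perm.sign x.2 := by
  simp [flip, T.glue_odd]

variable {T} {k : ι × TetEdge → R} {a : ι → Fin 4 → R}

theorem hasJump_zero (k : T.Edge → R) :
    T.HasJump (k ∘ T.edgeMk) 0 := by
  intro i v s hs
  simp [T.edgeMk_glue i v s hs]

theorem HasJump.apply_flip (hk : T.HasJump k a) (x : ι × Perm (Fin 4)) :
    k ((T.flip x).1, ofPerm (T.flip x).2) = k (x.1, ofPerm x.2) + a x.1 (x.2 2) := by
  rw [flip, ofPerm_mul]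
  exact hk _ _ _ (notMem_ofPerm_two _)

theorem HasJump.vertexWeight_flip (hk : T.HasJump k a) (x : ι × Perm (Fin 4)) :
    vertexWeight (fun s => k ((T.flip x).1, s)) (T.flip x).2
      = vertexWeight (fun s => k (x.1, s)) x.2 + a x.1 (x.2 2) := by
  have h1 := hk.apply_flip (x.1, x.2 * swap 1 3)
  have h2 := hk.apply_flip (x.1, x.2 * swap 0 1)
  have e1 : (x.2 * swap 1 3 : Perm (Fin 4)) 2 = x.2 2 := by
    rw [Perm.mul_apply, swap_apply_of_ne_of_ne] <;> decide
  have e2 : (x.2 * swap 0 1 : Perm (Fin 4)) 2 = x.2 2 := by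
    rw [Perm.mul_apply, swap_apply_of_ne_of_ne] <;> decide
  simp only [flip, e1, e2, ← mul_assoc] at h1 h2
  have h3 := hk.apply_flip x
  simp only [flip] at h3
  simp only [vertexWeight, flip, h1, h2, h3]
  ring

/-- Consecutive arcs of a curve see the same vertex weight in their common face, up to the jump. -/
theorem Follows.vertexWeight (hk : T.HasJump k a) {x y : ι × Perm (Fin 4)}
    (h : T.Follows x y) :
    vertexWeight (fun s => k (y.1, s)) (y.2 * swap 1 2)
      = vertexWeight (fun s => k (x.1, s)) x.2 + a x.1 (x.2 2) := by
  obtain ⟨h1, h2, h3⟩ := h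
  rw [← hk.vertexWeight_flip]
  have key : ∀ τ : Perm (Fin 4), τ 0 = 0 → τ 2 = 2 → τ = 1 ∨ τ = swap 1 3 := by decide +kernel
  have e : y.2 * swap 1 2 = (T.flip x).2 * ((T.flip x).2⁻¹ * (y.2 * swap 1 2)) := by group
  have h0 : swap (1 : Fin 4) 2 0 = 0 := by decide
  rcases key ((T.flip x).2⁻¹ * (y.2 * swap 1 2)) (by simp [flip, h2, h0])
    (by simp [flip, h3]) with h' | h' <;> rw [e, h']
  · rw [mul_one, h1]; rfl
  · rw [vertexWeight_mul_swap_one_three, h1]; rfl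

theorem sum_gluing_mul [Fintype T.Edge] (k : T.Edge → R) (q : Fin 3) (j : ι) :
    ∑ e, k e * (T.gluing q e j : R) = quadSums (k ∘ T.edgeMk) q j := by
  classical
  simp only [gluing_eq_card, Finset.card_filter, Nat.cast_sum, Finset.mul_sum, quadSums, quadSum]
  rw [Finset.sum_comm]
  refine Finset.sum_congr rfl fun s _ => ?_
  rw [Finset.sum_eq_single (T.edgeMk (j, s))]
  · simp
  · intro e _ he
    simp [he.symm]
  · simp

variable [Fintype ι]

/-- The pairing of the coefficients of the completeness equation of `γ` with the symplectic dual of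
the quad sums of `k` is the total jump of `k` along `γ`, up to sign. -/
theorem HasJump.symplecticForm_coeff (hk : T.HasJump k a) (γ : T.NormalLoop) :
    symplecticForm (fun q j => (γ.coeff q j : R)) (quadSums k)
      = -∑ l ∈ Finset.range γ.len, a (γ.arc l).1 ((γ.arc l).2 2) := by
  classical
  have h1 : symplecticForm (fun q j => (γ.coeff q j : R)) (quadSums k)
      = ∑ l ∈ Finset.range γ.len,
        (TetEdge.vertexWeight (fun s => k ((γ.arc l).1, s)) (γ.arc l).2 -
          TetEdge.vertexWeight (fun s => k ((γ.arc l).1, s)) ((γ.arc l).2 * swap 1 2)) := by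
    simp only [symplecticForm, NormalLoop.coeff, Int.cast_sum, Finset.sum_mul]
    rw [Finset.sum_congr rfl fun q _ => Finset.sum_comm, Finset.sum_comm]
    refine Finset.sum_congr rfl fun l _ => ?_
    rw [← sign_mul_quadSum_sub, Finset.sum_eq_single (quadOf (ofPerm (γ.arc l).2)),
      Finset.sum_eq_single (γ.arc l).1]
    · simp [mem_quad_iff, quadSums]
    · intro j _ hj
      simp [hj.symm]
    · simp
    · intro q _ hq
      simp [mem_quad_iff, hq.symm]
    · simp
  have h2 : ∀ F : ℕ → R, F γ.len = F 0 →
      ∑ l ∈ Finset.range γ.len, F (l + 1) = ∑ l ∈ Finset.range γ.len, F l := by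
    intro F hF
    have := Finset.sum_range_sub F γ.len
    rw [hF, sub_self, Finset.sum_sub_distrib] at this
    exact sub_eq_zero.1 this
  rw [h1, Finset.sum_sub_distrib,
    ← h2 (fun l => TetEdge.vertexWeight (fun s => k ((γ.arc l).1, s)) ((γ.arc l).2 * swap 1 2))
      (by have := γ.periodic 0; rw [zero_add] at this; simp only [this]),
    ← Finset.sum_sub_distrib, ← Finset.sum_neg_distrib]
  refine Finset.sum_congr rfl fun l _ => ?_
  rw [(γ.follows l).vertexWeight hk]
  ring

/-- The gluing equation of `e` is orthogonal to the quad sums of `k`: summed over the corners at `e`,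
the vertex weights cancel across the faces, and the jumps cancel between the two ends of `e`. -/
theorem HasJump.symplecticForm_gluing [NoZeroDivisors R] [CharZero R] (hk : T.HasJump k a)
    (e : T.Edge) :
    symplecticForm (fun q j => (T.gluing q e j : R)) (quadSums k) = 0 := by
  classical
  let W : ι × Perm (Fin 4) → R := fun x => TetEdge.vertexWeight (fun s => k (x.1, s)) x.2
  let σ : ι × Perm (Fin 4) → R := fun x => (((Perm.sign x.2 : ℤˣ) : ℤ) : R)
  let X : Finset (ι × Perm (Fin 4)) := Finset.univ.filter fun x => T.arcEdge x = e
  have hX : ∀ x, x ∈ X ↔ T.arcEdge x = e := fun x => by simp [X]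
  -- right multiplication by a transposition that fixes the edge
  have hswap : ∀ i j : Fin 4, i ≠ j → (∀ π, ofPerm (π * swap i j) = ofPerm π) →
      ∀ F : ι × Perm (Fin 4) → R,
        ∑ x ∈ X, σ x * F (x.1, x.2 * swap i j) = -∑ x ∈ X, σ x * F x := by
    intro i j hij hs F
    rw [← Finset.sum_neg_distrib]
    refine Finset.sum_nbij' (fun x => (x.1, x.2 * swap i j)) (fun x => (x.1, x.2 * swap i j))
      ?_ ?_ ?_ ?_ ?_
    · intro x hx; rw [hX] at hx ⊢; rwa [arcEdge, hs]
    · intro x hx; rw [hX] at hx ⊢; rwa [arcEdge, hs]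
    · intro x _; simp [mul_assoc]
    · intro x _; simp [mul_assoc]
    · intro x _; simp [σ, Perm.sign_swap hij]
  have hflip : ∑ x ∈ X, σ x * W x = -∑ x ∈ X, σ x * (W x + a x.1 (x.2 2)) := by
    rw [← Finset.sum_neg_distrib]
    refine Finset.sum_nbij' T.flip T.flip ?_ ?_ ?_ ?_ ?_
    · intro x hx; rw [hX] at hx ⊢; rwa [T.arcEdge_flip]
    · intro x hx; rw [hX] at hx ⊢; rwa [T.arcEdge_flip]
    · intro x _; exact T.flip_flip x
    · intro x _; exact T.flip_flip x
    · intro x _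
      have h1 := hk.vertexWeight_flip (T.flip x)
      have h2 : σ (T.flip x) = -σ x := by simp [σ, T.sign_flip]
      rw [T.flip_flip] at h1
      simp only [W]
      rw [h2, ← h1]
      ring
  have ha : ∑ x ∈ X, σ x * a x.1 (x.2 2) = 0 := by
    have h := hswap 0 3 (by decide) ofPerm_mul_swap_zero_three (fun x => a x.1 (x.2 2))
    have h0 : swap (0 : Fin 4) 3 2 = 2 := by decide
    simp only [Perm.mul_apply, h0] at h
    exact self_eq_neg.1 h
  have hW : ∑ x ∈ X, σ x * W x = 0 := by
    simp only [mul_add, Finset.sum_add_distrib, ha, add_zero] at hflip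
    exact self_eq_neg.1 hflip
  have hmain : 4 * symplecticForm (fun q j => (T.gluing q e j : R)) (quadSums k)
      = ∑ x ∈ X, σ x * (W x - W (x.1, x.2 * swap 1 2)) := by
    have h1 : symplecticForm (fun q j => (T.gluing q e j : R)) (quadSums k)
        = ∑ j, ∑ s, if T.edgeMk (j, s) = e then
          quadSums k (quadOf s + 1) j - quadSums k (quadOf s + 2) j else 0 := by
      rw [symplecticForm, Finset.sum_comm]
      refine Finset.sum_congr rfl fun j _ => ?_
      rw [← sum_quad fun q s => if T.edgeMk (j, s) = e then
          quadSums k (q + 1) j - quadSums k (q + 2) j else 0]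
      refine Finset.sum_congr rfl fun q _ => ?_
      rw [← Finset.sum_filter, Finset.sum_const, nsmul_eq_mul, gluing_eq_card]
    rw [h1, Finset.mul_sum, Finset.sum_filter, Fintype.sum_prod_type]
    refine Finset.sum_congr rfl fun j _ => ?_
    have h2 := sum_ofPerm fun s => if T.edgeMk (j, s) = e then
          quadSums k (quadOf s + 1) j - quadSums k (quadOf s + 2) j else 0
    rw [nsmul_eq_mul] at h2
    rw [← Nat.cast_ofNat, ← h2]
    refine Finset.sum_congr rfl fun π _ => ?_
    have h3 := sign_mul_quadSum_sub (fun s => k (j, s)) π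
    simp only [W, σ, ← h3, arcEdge, quadSums]
    rcases Int.units_eq_one_or (Perm.sign π) with h | h <;> simp [h]
  have hfin : 4 * symplecticForm (fun q j => (T.gluing q e j : R)) (quadSums k) = 0 := by
    simp only [mul_sub, Finset.sum_sub_distrib] at hmain
    rw [hmain, hswap 1 2 (by decide) ofPerm_mul_swap_one_two W, hW, neg_zero, sub_zero]
  exact (mul_eq_zero.1 hfin).resolve_left (by norm_num)

end Weights

/-! ### Constant weights and heights in the infinite cyclic cover -/

section Potential

variable {T : IdealTriangulation ι}

/-- On a triangulation with one cusp, an edge weight whose quad sums agree in each tetrahedron is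
constant, up to 2-torsion: the vertex weights are then a function on the set of cusps. -/
theorem exists_two_mul_eq_of_quadSums_eq {R : Type*} [CommRing R] (hT : T.IsOneCusped)
    (k : T.Edge → R)
    (h : ∀ q j, quadSums (k ∘ T.edgeMk) (q + 1) j = quadSums (k ∘ T.edgeMk) (q + 2) j) :
    ∃ y, ∀ e, 2 * k e = 2 * y := by
  have hk : T.HasJump (k ∘ T.edgeMk) 0 := hasJump_zero k
  let W : ι → Perm (Fin 4) → R := fun i π => vertexWeight (fun s => k (T.edgeMk (i, s))) π
  have h12 : ∀ i π, W i (π * swap 1 2) = W i π := by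
    intro i π
    have := sign_mul_quadSum_sub (fun s => k (T.edgeMk (i, s))) π
    have h' := h (quadOf (ofPerm π)) i
    simp only [quadSums, Function.comp_def] at h'
    rw [h', sub_self, mul_zero] at this
    exact (sub_eq_zero.1 this.symm).symm
  have hW : ∀ i {π σ : Perm (Fin 4)}, π 0 = σ 0 → W i π = W i σ := fun i =>
    eq_of_apply_zero_eq _ (h12 i) (fun π => vertexWeight_mul_swap_one_three _ π)
  let g : T.Cusp → R := Quot.lift (fun x => W x.1 (swap 0 x.2)) (by
    rintro _ _ ⟨i, v, w, hvw⟩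
    obtain ⟨π, hπ0, hπ2⟩ : ∃ π : Perm (Fin 4), π 0 = w ∧ π 2 = v := by
      revert v w
      decide +kernel
    have h1 := hk.vertexWeight_flip (i, π)
    simp only [Pi.zero_apply, add_zero, flip, hπ2] at h1
    calc W i (swap 0 w) = W i π := hW i (by simp [hπ0])
      _ = W (T.nbr i v) (T.glue i v * π) := h1.symm
      _ = _ := hW _ (by simp [hπ0]))
  obtain ⟨c⟩ := hT.nonempty
  have := hT.subsingleton
  have hc : ∀ i π, W i π = g c := by
    intro i π
    rw [Subsingleton.elim c (Quot.mk _ (i, π 0))]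
    exact hW i (by simp)
  refine ⟨g c, fun e => ?_⟩
  obtain ⟨⟨i, s⟩, rfl⟩ := T.edgeMk_surjective e
  obtain ⟨π, rfl⟩ : ∃ π, ofPerm π = s := by
    revert s
    decide +kernel
  have h1 := vertexWeight_add_vertexWeight (fun s => k (T.edgeMk (i, s))) π
  rw [← h1, two_mul]
  exact congrArg₂ (· + ·) (hc i _) (hc i _)

/-- A function whose sums along the cycles of an injective self-map of a finite set vanish is
a coboundary. -/
theorem exists_potential {X : Type*} [Finite X] (f : X → X) (hf : Function.Injective f)
    (a : X → ℤ)
    (ha : ∀ x m, f^[m] x = x → ∑ k ∈ Finset.range m, a (f^[k] x) = 0) :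
    ∃ φ : X → ℤ, ∀ x, φ (f x) = φ x + a x := by
  classical
  have hadd : ∀ x m n, ∑ k ∈ Finset.range (m + n), a (f^[k] x)
      = ∑ k ∈ Finset.range m, a (f^[k] x) + ∑ k ∈ Finset.range n, a (f^[k] (f^[m] x)) := by
    intro x m n
    rw [Finset.sum_range_add]
    congr 1
    refine Finset.sum_congr rfl fun k _ => ?_
    rw [add_comm, Function.iterate_add_apply]
  -- sums between two points of a cycle do not depend on the number of turns
  have hwd : ∀ x m n, f^[m] x = f^[n] x →
      ∑ k ∈ Finset.range m, a (f^[k] x) = ∑ k ∈ Finset.range n, a (f^[k] x) := by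
    have : ∀ x m d, f^[m] x = f^[m + d] x →
        ∑ k ∈ Finset.range m, a (f^[k] x) = ∑ k ∈ Finset.range (m + d), a (f^[k] x) := by
      intro x m d h
      rw [hadd, ha (f^[m] x) d, add_zero]
      rw [← Function.iterate_add_apply, add_comm, ← h]
    intro x m n h
    rcases le_total m n with hmn | hmn
    · obtain ⟨d, rfl⟩ := Nat.exists_eq_add_of_le hmn
      exact this x m d h
    · obtain ⟨d, rfl⟩ := Nat.exists_eq_add_of_le hmn
      exact (this x n d h.symm).symm
  let S : Setoid X :=
    { r := fun x y => ∃ m, f^[m] x = y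
      iseqv :=
        { refl := fun x => ⟨0, rfl⟩
          symm := by
            rintro x _ ⟨m, rfl⟩
            obtain ⟨n, hn, hx⟩ := hf.mem_periodicPts x
            refine ⟨n * m - m, ?_⟩
            rw [← Function.iterate_add_apply,
              Nat.sub_add_cancel (Nat.le_mul_of_pos_left m hn)]
            exact hx.mul_const m
          trans := by
            rintro x _ _ ⟨m, rfl⟩ ⟨n, rfl⟩
            exact ⟨n + m, Function.iterate_add_apply _ _ _ _⟩ } }
  let r : X → X := fun x => (Quotient.mk S x).out
  have hr : ∀ x, ∃ m, f^[m] (r x) = x := fun x => Quotient.mk_out (s := S) x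
  choose m hm using hr
  refine ⟨fun x => ∑ k ∈ Finset.range (m x), a (f^[k] (r x)), fun x => ?_⟩
  have hrx : r (f x) = r x := by
    have : Quotient.mk S (f x) = Quotient.mk S x :=
      (Quotient.sound (s := S) (⟨1, rfl⟩ : ∃ m, f^[m] x = f x)).symm
    simp only [r, this]
  have h1 := hwd (r x) (m (f x)) (m x + 1) (by
    rw [← hrx, hm, hrx, Function.iterate_succ_apply', hm])
  simp only [hrx]
  rw [h1, Finset.sum_range_succ, hm]

theorem rotate_injective (T : IdealTriangulation ι) : Function.Injective T.rotate := by
  intro x y h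
  rw [rotate_eq, rotate_eq, Prod.mk.injEq, mul_left_inj] at h
  rw [← T.flip_flip x, ← T.flip_flip y, Prod.ext h.1 h.2]

theorem map_injective (σ : Perm (Fin 4)) : Function.Injective (TetEdge.map σ) := by
  intro s t h
  exact Subtype.ext (Finset.map_injective _ (congrArg Subtype.val h))

/-- An integral cocycle lifts the edges of the tetrahedra to compatible heights. -/
theorem Cocycle.exists_hasJump [Finite ι] (α : T.Cocycle) :
    ∃ κ : ι × TetEdge → ℤ, T.HasJump κ α.val := by
  classical
  obtain ⟨φ, hφ⟩ := exists_potential T.rotate T.rotate_injective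
    (fun x => α.val x.1 (x.2 2)) α.closed
  -- the average of the potential over the four arcs around an edge, rounded down
  refine ⟨fun x => (∑ π with ofPerm π = x.2, φ (x.1, π)) / 4, fun i v s hs => ?_⟩
  have hglue : ∀ π : Perm (Fin 4), ofPerm π = s →
      φ (T.nbr i v, T.glue i v * π) = φ (i, π * swap 1 2) + α.val i v := by
    intro π hπ
    have hv : π 1 = v ∨ π 2 = v := by
      subst hπ
      revert π v
      decide +kernel
    rcases hv with rfl | rfl
    · have h1 := hφ (i, π * swap 1 2)
      have h2 : (π * swap 1 2 : Perm (Fin 4)) 2 = π 1 := by simp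
      rw [rotate_eq, flip] at h1
      simp only [h2] at h1
      rwa [mul_assoc, mul_assoc, Equiv.swap_mul_self, mul_one] at h1
    · have h1 := hφ (T.flip (i, π))
      rw [rotate_eq, flip_flip] at h1
      simp only [flip, Perm.mul_apply, α.antisymm] at h1
      linarith
  have hsum : ∑ π with ofPerm π = s.map (T.glue i v), φ (T.nbr i v, π)
      = ∑ π with ofPerm π = s, (φ (i, π) + α.val i v) := by
    have e1 : ∑ π with ofPerm π = s.map (T.glue i v), φ (T.nbr i v, π)
        = ∑ π with ofPerm π = s, φ (T.nbr i v, T.glue i v * π) := by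
      symm
      refine Finset.sum_nbij' (T.glue i v * ·) ((T.glue i v)⁻¹ * ·) ?_ ?_ ?_ ?_ ?_
      · intro π hπ
        simpa [ofPerm_mul] using congrArg (map (T.glue i v)) (Finset.mem_filter.1 hπ).2
      · intro π hπ
        refine Finset.mem_filter.2 ⟨Finset.mem_univ _, map_injective (T.glue i v) ?_⟩
        rw [← ofPerm_mul, mul_inv_cancel_left]
        exact (Finset.mem_filter.1 hπ).2
      · simp
      · simp
      · simp
    rw [e1]
    refine Finset.sum_nbij' (· * swap 1 2) (· * swap 1 2) ?_ ?_ ?_ ?_ ?_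
    · simp [ofPerm_mul_swap_one_two]
    · simp [ofPerm_mul_swap_one_two]
    · simp [mul_assoc]
    · simp [mul_assoc]
    · intro π hπ
      exact hglue π (Finset.mem_filter.1 hπ).2
  simp only [hsum, Finset.sum_add_distrib, Finset.sum_const, card_filter_ofPerm]
  rw [nsmul_eq_mul, Nat.cast_ofNat, Int.add_mul_ediv_left _ _ (by norm_num)]

end Potential

end IdealTriangulation

/-! ### Kernels of isotropic matrices -/

namespace Matrix

/-- If the rows of `(A₀ | A₁)` span an isotropic subspace of half the dimension, then this subspace
is its own symplectic complement. -/
theorem exists_vecMul_of_isotropic {E m : Type*} [Fintype E] [Fintype m]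
    (A₀ A₁ : Matrix E m ℚ) (hiso : A₀ * A₁ᵀ = A₁ * A₀ᵀ)
    (hcard : Fintype.card E = Fintype.card m + 1) (u : E → ℚ)
    (hker : ∀ k, k ᵥ* A₀ = 0 → k ᵥ* A₁ = 0 → ∃ c : ℚ, c • u = k)
    (x y : m → ℚ) (hxy : A₀ *ᵥ x + A₁ *ᵥ y = 0) :
    ∃ k, k ᵥ* A₁ = x ∧ k ᵥ* A₀ = -y := by
  classical
  let A : Matrix E (m ⊕ m) ℚ := fromCols A₀ A₁
  let B : Matrix (m ⊕ m) E ℚ := fromRows A₁ᵀ (-A₀ᵀ)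
  have hAB : A * B = 0 := by
    simp [A, B, fromCols_mul_fromRows, hiso]
  have hrank : ∀ C : Matrix (m ⊕ m) E ℚ,
      (∀ k, C *ᵥ k = 0 → ∃ c : ℚ, c • u = k) → Fintype.card m ≤ C.rank := by
    intro C hC
    have h1 := C.mulVecLin.finrank_range_add_finrank_ker
    have h2 : Module.finrank ℚ (LinearMap.ker C.mulVecLin) ≤ 1 := by
      refine (Submodule.finrank_mono (t := Submodule.span ℚ {u}) fun k hk => ?_).trans
        ((finrank_span_le_card {u}).trans (by simp))
      exact Submodule.mem_span_singleton.2 (hC k hk)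
    rw [Module.finrank_fintype_fun_eq_card, hcard] at h1
    rw [Matrix.rank]
    omega
  have hB : Fintype.card m ≤ B.rank := by
    refine hrank B fun k hk => ?_
    have h1 := fun i => congrFun hk (Sum.inl i)
    have h2 := fun i => congrFun hk (Sum.inr i)
    refine hker k ?_ ?_
    · ext i
      have := h2 i
      simp only [B, fromRows_mulVec, Sum.elim_inr, neg_mulVec, mulVec_transpose] at this
      simpa using this
    · ext i
      have := h1 i
      simp only [B, fromRows_mulVec, Sum.elim_inl, mulVec_transpose] at this
      simpa using this
  have hA : Fintype.card m ≤ A.rank := by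
    rw [← rank_transpose]
    refine hrank Aᵀ fun k hk => ?_
    have h1 := fun i => congrFun hk (Sum.inl i)
    have h2 := fun i => congrFun hk (Sum.inr i)
    simp only [A, transpose_fromCols, fromRows_mulVec, Sum.elim_inl, mulVec_transpose] at h1
    simp only [A, transpose_fromCols, fromRows_mulVec, Sum.elim_inr, mulVec_transpose] at h2
    exact hker k (funext h1) (funext h2)
  have hle : LinearMap.range B.mulVecLin ≤ LinearMap.ker A.mulVecLin := by
    rintro _ ⟨k, rfl⟩
    simp [hAB]
  have heq : LinearMap.range B.mulVecLin = LinearMap.ker A.mulVecLin := by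
    refine Submodule.eq_of_le_of_finrank_le hle ?_
    have h1 := A.mulVecLin.finrank_range_add_finrank_ker
    rw [Module.finrank_fintype_fun_eq_card, Fintype.card_sum] at h1
    rw [Matrix.rank] at hA hB
    omega
  have hmem : Sum.elim x y ∈ LinearMap.ker A.mulVecLin := by
    simpa [A, fromCols_mulVec_sumElim] using hxy
  rw [← heq] at hmem
  obtain ⟨k, hk⟩ := hmem
  refine ⟨k, ?_, ?_⟩
  · ext i
    have := congrFun hk (Sum.inl i)
    simpa [B, fromRows_mulVec, mulVec_transpose] using this
  · ext i
    have := congrFun hk (Sum.inr i)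
    simp only [B, mulVecLin_apply, fromRows_mulVec, Sum.elim_inr, neg_mulVec,
      mulVec_transpose, Pi.neg_apply] at this
    simp [← this]

end Matrix

namespace IdealTriangulation

open TetEdge Equiv

variable {ι : Type*} {T : IdealTriangulation ι}

/-! ### Parity -/

/-- A function on the edges with values modulo 2 whose quad sums agree in each tetrahedron takes the
value 1 an even number of times on the edges of the tetrahedra: modulo 2, the sum over the edges
of a tetrahedron is the number of its faces on which the function is not constant, and the faces
are glued in pairs. -/
theorem sum_edges_eq_zero [Fintype ι] (k : T.Edge → ZMod 2)
    (h : ∀ q j, quadSums (k ∘ T.edgeMk) (q + 1) j = quadSums (k ∘ T.edgeMk) (q + 2) j) :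
    ∑ j, ∑ s, k (T.edgeMk (j, s)) = 0 := by
  classical
  have key : ∀ k : TetEdge → ZMod 2, (∀ q, quadSum k (q + 1) = quadSum k (q + 2)) →
      ∑ s, k s = ∑ v : Fin 4, if ∃ c, ∀ s : TetEdge, v ∉ s.1 → k s = c then 0 else 1 := by
    unfold quadSum
    decide +kernel
  rw [Finset.sum_congr rfl fun j _ => key (fun s => k (T.edgeMk (j, s))) fun q => h q j,
    ← Fintype.sum_prod_type' (f := fun j v =>
      if ∃ c, ∀ s : TetEdge, v ∉ s.1 → k (T.edgeMk (j, s)) = c then (0 : ZMod 2) else 1)]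
  refine Finset.sum_involution (fun x _ => (T.nbr x.1 x.2, T.glue x.1 x.2 x.2)) ?_ ?_ ?_ ?_
  · intro x _
    have : (∃ c, ∀ s : TetEdge, T.glue x.1 x.2 x.2 ∉ s.1 →
        k (T.edgeMk (T.nbr x.1 x.2, s)) = c) ↔
        ∃ c, ∀ s : TetEdge, x.2 ∉ s.1 → k (T.edgeMk (x.1, s)) = c := by
      refine exists_congr fun c => ⟨fun H s hs => ?_, fun H s hs => ?_⟩
      · rw [← T.edgeMk_glue x.1 x.2 s hs]
        exact H _ (by simpa [TetEdge.map] using hs)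
      · have h1 := T.edgeMk_glue (T.nbr x.1 x.2) (T.glue x.1 x.2 x.2) s hs
        rw [T.nbr_nbr, T.glue_glue] at h1
        rw [← h1]
        refine H _ ?_
        rw [TetEdge.map, Finset.mem_map_equiv]
        exact hs
    simp only [this]
    exact CharTwo.add_self_eq_zero _
  · intro x _ _ hx
    exact T.no_fold x.1 x.2 ⟨congrArg Prod.fst hx, congrArg Prod.snd hx⟩
  · simp
  · intro x _
    simp [T.nbr_nbr, T.glue_glue]

/-! ### Edge parameters and their logarithmic derivatives -/

theorem prod_zeta_zpow {z : ℂ} (h0 : z ≠ 0) (h1 : z ≠ 1) (X h : Fin 3 → ℤ)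
    (hX : ∀ q, h q = X (q + 1) - X (q + 2)) :
    ∏ q, zeta z q ^ h q = (-1) ^ (∑ q, X q) * (∏ q, shape z q ^ X q)⁻¹ := by
  have h2 : 1 - z ≠ 0 := sub_ne_zero.2 h1.symm
  have h3 : z - 1 ≠ 0 := sub_ne_zero.2 h1
  have e0 : zeta z 0 = z⁻¹ := by simp [zeta]
  have e1 : zeta z 1 = (1 - z)⁻¹ := by simp [zeta]
  have e2 : zeta z 2 = -1 * z⁻¹ * (1 - z)⁻¹ := by
    simp only [zeta, Matrix.cons_val]
    rw [← neg_sub 1 z]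
    field_simp
  have s0 : shape z 0 = z := by simp [shape]
  have s1 : shape z 1 = (1 - z)⁻¹ := by simp [shape]
  have s2 : shape z 2 = -1 * (1 - z) * z⁻¹ := by
    simp only [shape, Matrix.cons_val]
    field_simp
    ring
  have x0 := hX 0
  have x1 := hX 1
  have x2 := hX 2
  simp only [show (0 : Fin 3) + 1 = 1 from rfl, show (0 : Fin 3) + 2 = 2 from rfl,
    show (1 : Fin 3) + 1 = 2 from rfl, show (1 : Fin 3) + 2 = 0 from rfl,
    show (2 : Fin 3) + 1 = 0 from rfl, show (2 : Fin 3) + 2 = 1 from rfl] at x0 x1 x2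
  rw [Fin.prod_univ_three, Fin.prod_univ_three, Fin.sum_univ_three, e0, e1, e2, s0, s1, s2,
    x0, x1, x2]
  have hm : (-1 : ℂ) ≠ 0 := by norm_num
  have hneg : (-1 : ℂ) ^ (-X 1 * 2) = 1 := by
    rw [mul_comm, zpow_mul]; norm_num
  have key : (-1 : ℂ) ^ (X 0 - X 1) = (-1) ^ (X 0 + X 1 + X 2) * ((-1) ^ (X 2))⁻¹ := by
    rw [← zpow_neg, ← zpow_add₀ hm,
      show X 0 + X 1 + X 2 + -X 2 = X 0 - X 1 - -X 1 * 2 by ring, zpow_sub₀ hm (X 0 - X 1), hneg, div_one]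
  simp only [mul_zpow, key]
  simp only [zpow_sub₀ h0, zpow_sub₀ h2, inv_zpow', neg_sub, mul_inv, ← zpow_neg, neg_neg]
  simp only [zpow_neg]
  field_simp

end IdealTriangulation

/-! ### The lattice of differences of combinatorial flattenings -/

namespace IdealTriangulation

open TetEdge Equiv

variable {ι : Type*} {T : IdealTriangulation ι}

theorem finite_edge [Finite ι] : Finite T.Edge :=
  Finite.of_surjective T.edgeMk T.edgeMk_surjective

theorem map_quadSums {R S : Type*} [CommRing R] [CommRing S] (f : R →+* S)
    (k : ι × TetEdge → R) (q : Fin 3) (j : ι) :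
    f (quadSums k q j) = quadSums (f ∘ k) q j := by
  simp [quadSums, quadSum]

theorem quadSums_const {R : Type*} [CommRing R] (c : R) (q : Fin 3) (j : ι) :
    quadSums (fun _ => c) q j = 2 * c := by
  simp [quadSums, quadSum, card_quad]

theorem symplecticForm_sum [Fintype ι] {R E : Type*} [CommRing R] [Fintype E] (k : E → R)
    (B : E → Fin 3 → ι → R) (v : Fin 3 → ι → R) :
    symplecticForm (fun q j => ∑ e, k e * B e q j) v = ∑ e, k e * symplecticForm (B e) v := by
  simp only [symplecticForm, Finset.sum_mul, Finset.mul_sum]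
  rw [Finset.sum_congr rfl fun q _ => Finset.sum_comm, Finset.sum_comm]
  simp only [mul_assoc]

/-- The coefficient vectors of the gluing equations and, for `none`, of the completeness equation of
the curve `γ`. -/
noncomputable def equationRows (γ : T.NormalLoop) (R : Type*) [CommRing R] :
    Option T.Edge → Fin 3 → ι → R
  | none => fun q j => (γ.coeff q j : R)
  | some e => fun q j => (T.gluing q e j : R)

theorem sum_equationRows [Fintype T.Edge] (γ : T.NormalLoop) {R : Type*} [CommRing R]
    (k : Option T.Edge → R) (q : Fin 3) (j : ι) :
    ∑ o, k o * equationRows γ R o q j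
      = k none * γ.coeff q j + quadSums ((fun e => k (some e)) ∘ T.edgeMk) q j := by
  rw [Fintype.sum_option, ← sum_gluing_mul]
  rfl

theorem some_row_eq_quadSums [Fintype T.Edge] [DecidableEq T.Edge] (γ : T.NormalLoop) {R : Type*}
    [CommRing R] (e : T.Edge) :
    equationRows γ R (some e) = quadSums ((Pi.single e 1 : T.Edge → R) ∘ T.edgeMk) := by
  funext q j
  rw [← sum_gluing_mul, Finset.sum_eq_single e]
  · simp [equationRows]
  · intro b _ hb
    simp [hb]
  · simp

variable [Fintype ι]

/-- The gluing and completeness equations are in involution. -/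
theorem symplecticForm_equationRows [Finite T.Edge] (γ : T.NormalLoop) (a b : Option T.Edge) :
    symplecticForm (equationRows γ ℚ a) (equationRows γ ℚ b) = 0 := by
  classical
  have := Fintype.ofFinite T.Edge
  have h : ∀ (a : Option T.Edge) (e : T.Edge),
      symplecticForm (equationRows γ ℚ a) (equationRows γ ℚ (some e)) = 0 := by
    intro a e
    rw [some_row_eq_quadSums]
    rcases a with _ | a
    · exact ((hasJump_zero _).symplecticForm_coeff γ).trans (by simp)
    · exact (hasJump_zero _).symplecticForm_gluing a
  rcases b with _ | b
  · rcases a with _ | a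
    · exact symplecticForm_self _
    · rw [symplecticForm_antisymm, h, neg_zero]
  · exact h a b

theorem Cocycle.exists_hasJump_cast (α : T.Cocycle) : ∃ κ : ι × TetEdge → ℤ,
    T.HasJump (fun x => (κ x : ℚ)) (fun i v => (α.val i v : ℚ)) := by
  obtain ⟨κ, hκ⟩ := α.exists_hasJump
  exact ⟨κ, fun i v s hs => by simp [hκ i v s hs]⟩

/-- The heights `κ` of the edges in the infinite cyclic cover detect the coefficient of the
completeness equation in a linear combination of the equations. -/
theorem symplecticForm_sum_heights [Fintype T.Edge] {α : T.Cocycle} {μ : T.NormalLoop}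
    (hα : α.eval μ = 1) {κ : ι × TetEdge → ℤ}
    (hκ : T.HasJump (fun x => (κ x : ℚ)) (fun i v => (α.val i v : ℚ))) (k : Option T.Edge → ℚ) :
    symplecticForm (fun q j => ∑ o, k o * equationRows μ ℚ o q j)
      (quadSums fun x => (κ x : ℚ)) = -k none := by
  rw [symplecticForm_sum, Fintype.sum_option]
  have h1 : symplecticForm (equationRows μ ℚ none) (quadSums fun x => (κ x : ℚ)) = -1 := by
    refine (hκ.symplecticForm_coeff μ).trans ?_
    rw [← Int.cast_one, ← hα, Cocycle.eval]
    push_cast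
    rfl
  have h2 : ∀ e, symplecticForm (equationRows μ ℚ (some e)) (quadSums fun x => (κ x : ℚ)) = 0 :=
    fun e => hκ.symplecticForm_gluing e
  simp [h1, h2]

/-- Over the rational numbers, the solutions of the homogeneous linear equations are spanned by the
symplectic duals of these equations. -/
theorem exists_rat_combination (hT : T.IsOneCusped) [Fintype T.Edge] (α : T.Cocycle)
    (μ : T.NormalLoop) (hα : α.eval μ = 1) (h : Fin 3 → ι → ℚ) (h_tet : ∀ j, ∑ q, h q j = 0)
    (h_row : ∀ o, ∑ q, ∑ j, equationRows μ ℚ o q j * h q j = 0) :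
    ∃ k : Option T.Edge → ℚ, ∀ q j, h q j = ∑ o, k o * equationRows μ ℚ o (q + 1) j
      - ∑ o, k o * equationRows μ ℚ o (q + 2) j := by
  obtain ⟨κ, hκ⟩ := α.exists_hasJump_cast
  let B := equationRows μ ℚ
  let A₀ : Matrix (Option T.Edge) ι ℚ := Matrix.of fun o j => B o 0 j - B o 2 j
  let A₁ : Matrix (Option T.Edge) ι ℚ := Matrix.of fun o j => B o 1 j - B o 2 j
  have e01 : (0 : Fin 3) + 1 = 1 := rfl
  have e02 : (0 : Fin 3) + 2 = 2 := rfl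
  have e11 : (1 : Fin 3) + 1 = 2 := rfl
  have e12 : (1 : Fin 3) + 2 = 0 := rfl
  have e21 : (2 : Fin 3) + 1 = 0 := rfl
  have e22 : (2 : Fin 3) + 2 = 1 := rfl
  have hiso : A₀ * A₁.transpose = A₁ * A₀.transpose := by
    ext a b
    have h1 := symplecticForm_equationRows μ a b
    rw [← sub_eq_zero, ← h1]
    simp only [Matrix.mul_apply, Matrix.transpose_apply, symplecticForm, Fin.sum_univ_three,
      ← Finset.sum_add_distrib, ← Finset.sum_sub_distrib, A₀, A₁, B, Matrix.of_apply]
    refine Finset.sum_congr rfl fun j _ => ?_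
    simp only [e01, e02, e11, e12, e21, e22]
    ring
  have hcard : Fintype.card (Option T.Edge) = Fintype.card ι + 1 := by
    rw [Fintype.card_option, ← Nat.card_eq_fintype_card, hT.euler, Nat.card_eq_fintype_card]
  have hvec₀ : ∀ k j, Matrix.vecMul k A₀ j = ∑ o, k o * B o 0 j - ∑ o, k o * B o 2 j := by
    intro k j
    simp [Matrix.vecMul, dotProduct, A₀, mul_sub]
  have hvec₁ : ∀ k j, Matrix.vecMul k A₁ j = ∑ o, k o * B o 1 j - ∑ o, k o * B o 2 j := by
    intro k j
    simp [Matrix.vecMul, dotProduct, A₁, mul_sub]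
  have hker : ∀ k, Matrix.vecMul k A₀ = 0 → Matrix.vecMul k A₁ = 0 →
      ∃ c : ℚ, c • (fun o : Option T.Edge => o.elim 0 fun _ => (1 : ℚ)) = k := by
    intro k h0 h1
    have h0' : ∀ j, ∑ o, k o * B o 0 j = ∑ o, k o * B o 2 j := fun j => by
      rw [← sub_eq_zero, ← hvec₀, h0]; rfl
    have h1' : ∀ j, ∑ o, k o * B o 1 j = ∑ o, k o * B o 2 j := fun j => by
      rw [← sub_eq_zero, ← hvec₁, h1]; rfl
    have hq : ∀ q q' j, ∑ o, k o * B o q j = ∑ o, k o * B o q' j := by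
      intro q q' j
      fin_cases q <;> fin_cases q' <;> simp [h0' j, h1' j]
    have hnone : k none = 0 := by
      have h2 := symplecticForm_sum_heights hα hκ k
      rw [symplecticForm_antisymm] at h2
      have h3 : symplecticForm (quadSums fun x => (κ x : ℚ))
          (fun q j => ∑ o, k o * equationRows μ ℚ o q j) = 0 := by
        refine Finset.sum_eq_zero fun q _ => Finset.sum_eq_zero fun j _ => ?_
        exact mul_eq_zero_of_right _ (sub_eq_zero.2 (hq (q + 1) (q + 2) j))
      rw [h3] at h2
      linarith
    obtain ⟨y, hy⟩ := exists_two_mul_eq_of_quadSums_eq hT (fun e => k (some e)) (by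
      intro q j
      have h2 := hq (q + 1) (q + 2) j
      simp only [B, sum_equationRows, hnone, zero_mul, zero_add] at h2
      exact h2)
    refine ⟨y, funext fun o => ?_⟩
    rcases o with _ | e
    · simp [hnone]
    · have := hy e
      simp only [Pi.smul_apply, Option.elim, smul_eq_mul, mul_one]
      linarith
  have hxy : A₀.mulVec (h 0) + A₁.mulVec (h 1) = 0 := by
    ext o
    rw [Pi.add_apply, Pi.zero_apply, ← h_row o]
    simp only [Matrix.mulVec, dotProduct, Fin.sum_univ_three, ← Finset.sum_add_distrib, A₀, A₁,
      Matrix.of_apply]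
    refine Finset.sum_congr rfl fun j _ => ?_
    have := h_tet j
    rw [Fin.sum_univ_three] at this
    rw [show h 2 j = -h 0 j - h 1 j by linarith]
    ring
  obtain ⟨k, hk1, hk0⟩ := Matrix.exists_vecMul_of_isotropic A₀ A₁ hiso hcard _ hker _ _ hxy
  refine ⟨k, fun q j => ?_⟩
  have k0 := congrFun hk0 j
  have k1 := congrFun hk1 j
  have := h_tet j
  rw [Fin.sum_univ_three] at this
  rw [hvec₀, Pi.neg_apply] at k0
  rw [hvec₁] at k1
  simp only [B] at k0 k1
  fin_cases q
  · simp only [Fin.zero_eta, e01, e02]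
    linarith
  · simp only [Fin.mk_one, e11, e12]
    linarith
  · simp only [Fin.reduceFinMk, e21, e22]
    linarith

/-- If `h` is an integral vector and a rational combination of the symplectic duals of the gluing
equations, then `2 h` is an integral combination of them. -/
theorem exists_int_combination (hT : T.IsOneCusped) (h : Fin 3 → ι → ℤ) (k : T.Edge → ℚ)
    (hk : ∀ q j, (h q j : ℚ) = quadSums (k ∘ T.edgeMk) (q + 1) j
      - quadSums (k ∘ T.edgeMk) (q + 2) j) :
    ∃ l : T.Edge → ℤ, ∀ q j, 2 * h q j = quadSums (l ∘ T.edgeMk) (q + 1) j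
      - quadSums (l ∘ T.edgeMk) (q + 2) j := by
  classical
  have : Finite T.Edge := finite_edge
  have := Fintype.ofFinite T.Edge
  -- clear denominators
  obtain ⟨D, hD, K, hK⟩ : ∃ D : ℕ, D ≠ 0 ∧ ∃ K : T.Edge → ℤ, ∀ e, (K e : ℚ) = D * k e := by
    refine ⟨∏ e, (k e).den, Finset.prod_ne_zero_iff.2 fun e _ => (k e).den_nz,
      fun e => (k e).num * ∏ b ∈ Finset.univ.erase e, (k b).den, fun e => ?_⟩
    rw [← Finset.mul_prod_erase _ _ (Finset.mem_univ e)]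
    push_cast
    rw [mul_right_comm, mul_comm _ (k e), Rat.mul_den_eq_num]
  have hD0 : (D : ℤ) ≠ 0 := by exact_mod_cast hD
  have hKq : ∀ q j, ((quadSums (K ∘ T.edgeMk) q j : ℤ) : ℚ) = D * quadSums (k ∘ T.edgeMk) q j := by
    intro q j
    simp [quadSums, quadSum, hK, Finset.mul_sum]
  have hKh : ∀ q j, D * h q j = quadSums (K ∘ T.edgeMk) (q + 1) j
      - quadSums (K ∘ T.edgeMk) (q + 2) j := by
    intro q j
    have := hk q j
    rw [← @Int.cast_inj ℚ]
    push_cast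
    rw [hKq, hKq, this]
    ring
  -- modulo the denominator, the combination vanishes, so its coefficients are almost constant
  obtain ⟨y, hy⟩ := exists_two_mul_eq_of_quadSums_eq (R := ZMod D) hT (fun e => (K e : ZMod D)) (by
    intro q j
    have h1 := congrArg (Int.castRingHom (ZMod D)) (hKh q j)
    rw [map_sub, map_quadSums, map_quadSums] at h1
    simp only [map_mul, map_natCast, CharP.cast_eq_zero, zero_mul] at h1
    exact sub_eq_zero.1 h1.symm)
  obtain ⟨y, rfl⟩ := ZMod.intCast_surjective y
  have hdvd : ∀ e, (D : ℤ) ∣ 2 * (K e - y) := by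
    intro e
    rw [← ZMod.intCast_zmod_eq_zero_iff_dvd]
    · push_cast
      rw [mul_sub, hy e, sub_self]
  choose l hl using hdvd
  refine ⟨l, fun q j => ?_⟩
  have hlq : ∀ q, D * quadSums (l ∘ T.edgeMk) q j = 2 * quadSums (K ∘ T.edgeMk) q j - 4 * y := by
    intro q
    simp only [quadSums, quadSum, Finset.mul_sum, Function.comp_apply, ← hl, mul_sub,
      Finset.sum_sub_distrib, Finset.sum_const, card_quad]
    simp
    ring
  apply mul_left_cancel₀ hD0
  rw [mul_sub, hlq, hlq, mul_left_comm, hKh]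
  ring

/-- An integral solution of the homogeneous linear equations is the sum of a multiple of the dual of
the completeness equation and half of an integral combination of the duals of the gluing
equations. The first coefficient is integral because it is the pairing with the heights of the
edges in the infinite cyclic cover. -/
theorem exists_int_combination_of_isSolution (hT : T.IsOneCusped) (α : T.Cocycle)
    (μ : T.NormalLoop) (hα : α.eval μ = 1) (h : Fin 3 → ι → ℤ) (h_tet : ∀ j, ∑ q, h q j = 0)
    (h_edge : ∀ e : T.Edge, ∑ q, ∑ j, (T.gluing q e j : ℤ) * h q j = 0)
    (h_cusp : ∑ q, ∑ j, μ.coeff q j * h q j = 0) :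
    ∃ (m : ℤ) (l : T.Edge → ℤ), ∀ q j,
      2 * (h q j - m * (μ.coeff (q + 1) j - μ.coeff (q + 2) j))
        = quadSums (l ∘ T.edgeMk) (q + 1) j - quadSums (l ∘ T.edgeMk) (q + 2) j := by
  have : Finite T.Edge := finite_edge
  have := Fintype.ofFinite T.Edge
  obtain ⟨k, hk⟩ := exists_rat_combination hT α μ hα (fun q j => (h q j : ℚ))
    (fun j => by exact_mod_cast h_tet j) (by
      rintro (_ | e)
      · have := congrArg (Int.cast : ℤ → ℚ) h_cusp
        push_cast at this
        exact this
      · have := congrArg (Int.cast : ℤ → ℚ) (h_edge e)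
        push_cast at this
        exact this)
  obtain ⟨κ, hκ⟩ := α.exists_hasJump_cast
  obtain ⟨m, hm⟩ : ∃ m : ℤ, k none = m := by
    have h1 := symplecticForm_sum_heights hα hκ k
    rw [symplecticForm_antisymm, neg_inj] at h1
    refine ⟨∑ q, ∑ j, quadSums κ q j * h q j, ?_⟩
    rw [← h1, symplecticForm]
    push_cast
    refine Finset.sum_congr rfl fun q _ => Finset.sum_congr rfl fun j _ => ?_
    rw [← hk]
    have := map_quadSums (Int.castRingHom ℚ) κ q j
    simp only [eq_intCast] at this
    rw [this]
    rfl
  obtain ⟨l, hl⟩ := exists_int_combination hT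
    (fun q j => h q j - m * (μ.coeff (q + 1) j - μ.coeff (q + 2) j)) (fun e => k (some e)) (by
      intro q j
      have := hk q j
      rw [sum_equationRows, sum_equationRows, hm] at this
      push_cast
      rw [this]
      ring)
  exact ⟨m, l, hl⟩

theorem zeta_ne_zero {z : ℂ} (h0 : z ≠ 0) (h1 : z ≠ 1) (q : Fin 3) : zeta z q ≠ 0 := by
  have h2 : 1 - z ≠ 0 := sub_ne_zero.2 h1.symm
  have h3 : z - 1 ≠ 0 := sub_ne_zero.2 h1
  fin_cases q <;> simp [zeta, h0, h2, h3]

theorem flatteningFactor_add {z : ι → ℂ} (hz : ∀ j q, zeta (z j) q ≠ 0) (f g : Fin 3 → ι → ℤ) :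
    flatteningFactor z (f + g) = flatteningFactor z f * flatteningFactor z g := by
  simp only [flatteningFactor, ← Finset.prod_mul_distrib, Pi.add_apply]
  exact Finset.prod_congr rfl fun j _ => Finset.prod_congr rfl fun q _ => zpow_add₀ (hz j q) _ _

theorem flatteningFactor_zsmul {z : ι → ℂ} (m : ℤ) (f : Fin 3 → ι → ℤ) :
    flatteningFactor z (m • f) = flatteningFactor z f ^ m := by
  simp only [flatteningFactor, ← Finset.prod_zpow, ← zpow_mul, Pi.smul_apply, smul_eq_mul,
    mul_comm m]

theorem flatteningFactor_ne_zero {z : ι → ℂ} (hz : ∀ j q, zeta (z j) q ≠ 0)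
    (f : Fin 3 → ι → ℤ) : flatteningFactor z f ≠ 0 :=
  Finset.prod_ne_zero_iff.2 fun j _ => Finset.prod_ne_zero_iff.2 fun q _ =>
    zpow_ne_zero _ (hz j q)

theorem prod_zpow_eq_zpow_sum {κ : Type*} (s : Finset κ) {a : ℂ} (ha : a ≠ 0) (f : κ → ℤ) :
    ∏ i ∈ s, a ^ f i = a ^ ∑ i ∈ s, f i := by
  classical
  induction s using Finset.induction_on with
  | empty => simp
  | insert i s hi ih => rw [Finset.prod_insert hi, Finset.sum_insert hi, zpow_add₀ ha, ih]

theorem neg_one_zpow_sq (m : ℤ) : ((-1 : ℂ) ^ m) ^ 2 = 1 := by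
  rw [← zpow_natCast, ← zpow_mul, mul_comm, zpow_mul]
  norm_num

/-- For the symplectic dual of an integral vector `X`, the product of the powers of the logarithmic
derivatives is, up to sign, the inverse of the product of the powers of the parameters. -/
theorem flatteningFactor_dual {z : ι → ℂ} (h0 : ∀ j, z j ≠ 0) (h1 : ∀ j, z j ≠ 1)
    (X h : Fin 3 → ι → ℤ) (hX : ∀ q j, h q j = X (q + 1) j - X (q + 2) j)
    (hs : ∏ j, ∏ q, shape (z j) q ^ X q j = 1) :
    flatteningFactor z h = (-1) ^ ∑ j, ∑ q, X q j := by
  rw [flatteningFactor, Finset.prod_congr rfl fun j _ =>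
    prod_zeta_zpow (h0 j) (h1 j) (fun q => X q j) (fun q => h q j) fun q => hX q j]
  rw [Finset.prod_mul_distrib, Finset.prod_inv_distrib, hs, inv_one, mul_one]
  exact prod_zpow_eq_zpow_sum _ (by norm_num) _

/-- The products defining the 1-loop invariants do not depend on the flattening, up to sign. -/
theorem flatteningFactor_sq_eq_one (hT : T.IsOneCusped) (α : T.Cocycle)
    (μ : T.NormalLoop) (hμ : μ.IsPeripheral) (hα : α.eval μ = 1) {z : ι → ℂ}
    (hz : T.IsCompleteShape z) (h : Fin 3 → ι → ℤ) (h_tet : ∀ j, ∑ q, h q j = 0)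
    (h_edge : ∀ e : T.Edge, ∑ q, ∑ j, (T.gluing q e j : ℤ) * h q j = 0)
    (h_cusp : ∑ q, ∑ j, μ.coeff q j * h q j = 0) :
    flatteningFactor z h ^ 2 = 1 := by
  classical
  have : Finite T.Edge := finite_edge
  have := Fintype.ofFinite T.Edge
  have hζ : ∀ j q, zeta (z j) q ≠ 0 := fun j q => zeta_ne_zero (hz.ne_zero j) (hz.ne_one j) q
  obtain ⟨m, l, hl⟩ := exists_int_combination_of_isSolution hT α μ hα h h_tet h_edge h_cusp
  let c : Fin 3 → ι → ℤ := fun q j => μ.coeff (q + 1) j - μ.coeff (q + 2) j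
  let g : Fin 3 → ι → ℤ := h - m • c
  have hg : ∀ q j, g q j = h q j - m * (μ.coeff (q + 1) j - μ.coeff (q + 2) j) := by
    intro q j; simp [g, c]
  have hc : flatteningFactor z c ^ 2 = 1 := by
    rw [flatteningFactor_dual hz.ne_zero hz.ne_one (fun q j => μ.coeff q j) c (fun _ _ => rfl)
      (hz.cusp μ hμ)]
    exact neg_one_zpow_sq _
  have hX : ∏ j, ∏ q, shape (z j) q ^ quadSums (l ∘ T.edgeMk) q j = 1 := by
    have hs : ∀ j q, shape (z j) q ≠ 0 := by
      intro j q
      have h2 : 1 - z j ≠ 0 := sub_ne_zero.2 (hz.ne_one j).symm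
      have h3 : 1 - (z j)⁻¹ ≠ 0 := by
        rw [sub_ne_zero]
        exact fun h => hz.ne_one j (inv_eq_one.1 h.symm)
      fin_cases q <;> simp [shape, hz.ne_zero j, h2, h3]
    have h1 : ∀ j q, shape (z j) q ^ quadSums (l ∘ T.edgeMk) q j
        = ∏ e, (shape (z j) q ^ T.gluing q e j) ^ l e := by
      intro j q
      rw [← sum_gluing_mul, ← prod_zpow_eq_zpow_sum _ (hs j q)]
      refine Finset.prod_congr rfl fun e _ => ?_
      rw [mul_comm, zpow_mul]
      exact congrArg (· ^ l e) (zpow_natCast _ _)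
    simp only [h1]
    rw [Finset.prod_congr rfl fun j _ => Finset.prod_comm, Finset.prod_comm]
    refine Finset.prod_eq_one fun e _ => ?_
    simp only [Finset.prod_zpow, hz.edge e, one_zpow]
  have hsq : flatteningFactor z g ^ 2 = 1 := by
    have h1 : flatteningFactor z ((2 : ℤ) • g) = _ :=
      flatteningFactor_dual hz.ne_zero hz.ne_one (quadSums (l ∘ T.edgeMk)) _ (fun q j => by
        rw [← hl, ← hg]; rfl) hX
    rw [flatteningFactor_zsmul] at h1
    rw [← zpow_natCast, Nat.cast_ofNat, h1]
    have heven : Even (∑ j, ∑ q, quadSums (l ∘ T.edgeMk) q j) := by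
      have h2 := sum_edges_eq_zero (fun e : T.Edge => (l e : ZMod 2)) (by
        intro q j
        have h3 := congrArg (Int.castRingHom (ZMod 2)) (hl q j)
        rw [map_sub, map_quadSums, map_quadSums, map_mul] at h3
        have h4 : Int.castRingHom (ZMod 2) 2 = 0 := rfl
        rw [h4, zero_mul] at h3
        exact sub_eq_zero.1 h3.symm)
      rw [even_iff_two_dvd, ← Nat.cast_ofNat, ← ZMod.intCast_zmod_eq_zero_iff_dvd, ← h2]
      push_cast
      refine Finset.sum_congr rfl fun j _ => ?_
      simp only [quadSums, quadSum, Int.cast_sum]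
      exact sum_quad fun _ s => (((l ∘ T.edgeMk) (j, s) : ℤ) : ZMod 2)
    exact heven.neg_one_zpow
  have hh : h = g + m • c := by simp [g]
  rw [hh, flatteningFactor_add hζ, flatteningFactor_zsmul, mul_pow, hsq, one_mul, ← zpow_natCast,
    zpow_comm, zpow_natCast, hc, one_zpow]

end IdealTriangulation

/-! ### Cyclic covers -/

namespace IdealTriangulation

open TetEdge Equiv

variable {ι : Type*} {T : IdealTriangulation ι} {α : T.Cocycle} {κ : ι × TetEdge → ℤ}

/-- In terms of the heights `κ`, an edge of the cover is an edge of the triangulation together with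
an element of the deck group. -/
def coverEdgeEquiv (hκ : T.HasJump κ α.val) (Γ : Type*) [Ring Γ] :
    (cover α Γ).Edge ≃ T.Edge × Γ where
  toFun := Quot.lift (fun x => (T.edgeMk (x.1.1, x.2), x.1.2 - (κ (x.1.1, x.2) : Γ))) (by
    rintro _ _ ⟨⟨i, g⟩, v, s, hs⟩
    refine Prod.ext (T.edgeMk_glue i v s hs).symm ?_
    have h := hκ i v s hs
    simp only [cover] at h ⊢
    rw [h]
    push_cast
    abel)
  invFun x := Quot.lift (fun y => (cover α Γ).edgeMk ((y.1, x.2 + (κ y : Γ)), y.2)) (by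
    rintro _ _ ⟨i, v, s, hs⟩
    rw [← (cover α Γ).edgeMk_glue (i, x.2 + (κ (i, s) : Γ)) v s hs, hκ i v s hs]
    simp [cover, add_assoc]) x.1
  left_inv := by
    rintro ⟨⟨⟨i, g⟩, s⟩⟩
    simp only [edgeMk, sub_add_cancel]
    rfl
  right_inv := by
    rintro ⟨⟨i, s⟩, g⟩
    simp [edgeMk]

section Gluing

variable (hκ : T.HasJump κ α.val) {Γ : Type*} [Ring Γ]

theorem coverProj_eq (e : (cover α Γ).Edge) :
    coverProj α Γ e = (coverEdgeEquiv hκ Γ e).1 := by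
  obtain ⟨x⟩ := e
  rfl

open Classical in
theorem cover_gluing (q : Fin 3) (e : (cover α Γ).Edge) (j : ι) (g : Γ) :
    (cover α Γ).gluing q e (j, g) = ((quad q).filter fun s =>
      T.edgeMk (j, s) = (coverEdgeEquiv hκ Γ e).1 ∧
        g - (κ (j, s) : Γ) = (coverEdgeEquiv hκ Γ e).2).card := by
  rw [gluing_eq_card]
  congr 1
  refine Finset.filter_congr fun s _ => ?_
  rw [← (coverEdgeEquiv hκ Γ).apply_eq_iff_eq, Prod.ext_iff]
  rfl

theorem sum_cover_gluing [Fintype Γ] (q : Fin 3) (e : T.Edge) (j : ι) (g : Γ) :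
    ∑ d, (cover α Γ).gluing q ((coverEdgeEquiv hκ Γ).symm (e, d)) (j, g) = T.gluing q e j := by
  classical
  simp only [cover_gluing hκ, apply_symm_apply, gluing_eq_card, Finset.card_filter]
  rw [Finset.sum_comm]
  refine Finset.sum_congr rfl fun s _ => ?_
  rw [Finset.sum_eq_single (g - (κ (j, s) : Γ))]
  · simp
  · intro d _ hd
    simp [hd.symm]
  · simp

/-- Each edge of `j` over the edge of `e` has exactly one translate that lies on `e`; it is determined
by the heights. -/
theorem twistedGluing_eq (q : Fin 3) (e : (cover α ℤ).Edge) (j : ι) [DecidableEq T.Edge] :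
    twistedGluing α q e j = ∑ s ∈ quad q, if T.edgeMk (j, s) = (coverEdgeEquiv hκ ℤ e).1 then
      LaurentPolynomial.T (κ (j, s) + (coverEdgeEquiv hκ ℤ e).2) else 0 := by
  classical
  have h1 : ∀ k : ℤ, LaurentPolynomial.C ((cover α ℤ).gluing q e (j, k) : ℂ) *
      LaurentPolynomial.T k = ∑ s ∈ quad q,
        if k = κ (j, s) + (coverEdgeEquiv hκ ℤ e).2 then
          if T.edgeMk (j, s) = (coverEdgeEquiv hκ ℤ e).1 then
            (LaurentPolynomial.T (κ (j, s) + (coverEdgeEquiv hκ ℤ e).2) : LaurentPolynomial ℂ)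
          else 0 else 0 := by
    intro k
    rw [cover_gluing hκ, Finset.card_filter]
    push_cast
    rw [map_sum, Finset.sum_mul]
    refine Finset.sum_congr rfl fun s _ => ?_
    by_cases hs : T.edgeMk (j, s) = (coverEdgeEquiv hκ ℤ e).1
    · by_cases hk : k = κ (j, s) + (coverEdgeEquiv hκ ℤ e).2
      · have hk' : k - κ (j, s) = (coverEdgeEquiv hκ ℤ e).2 := by rw [hk]; ring
        simp [hs, ← hk, hk']
      · have hk' : k - κ (j, s) ≠ (coverEdgeEquiv hκ ℤ e).2 := fun h => hk (by rw [← h]; ring)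
        simp [hk, hk']
    · simp [hs]
  rw [twistedGluing, finsum_congr h1, finsum_sum_comm]
  · refine Finset.sum_congr rfl fun s _ => ?_
    rw [finsum_eq_single _ (κ (j, s) + (coverEdgeEquiv hκ ℤ e).2)]
    · simp
    · intro k hk
      simp [hk]
  · intro s _
    refine (Set.finite_singleton (κ (j, s) + (coverEdgeEquiv hκ ℤ e).2)).subset fun k hk => ?_
    by_contra h
    exact hk (by simp only [Set.mem_singleton_iff] at h; simp [h])

end Gluing

section LiftPow

variable (n : ℕ) [NeZero n]

theorem sum_range_mul_len {R : Type*} [AddCommMonoid R] (f : ℕ → R) (m len : ℕ) :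
    ∑ k ∈ Finset.range (m * len), f k
      = ∑ b ∈ Finset.range len, ∑ a ∈ Finset.range m, f (b + a * len) := by
  rw [Finset.sum_comm]
  induction m with
  | zero => simp
  | succ m ih =>
    rw [Nat.succ_mul, Finset.sum_range_add, ih, Finset.sum_range_succ]
    simp only [add_comm]

/-- The lift of `μ ^ n` passes exactly once through each lift of each arc of `μ`. -/
theorem coeff_liftPow (μ : T.NormalLoop) (hα : α.eval μ = 1) (q : Fin 3) (j : ι)
    (l : ZMod n) : (μ.liftPow α n).coeff q (j, l) = μ.coeff q j := by
  classical
  simp only [NormalLoop.coeff, NormalLoop.liftPow]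
  rw [sum_range_mul_len]
  refine Finset.sum_congr rfl fun b _ => ?_
  simp only [μ.arc_add_mul, μ.sheet_add_mul, hα, mul_one, Prod.mk.injEq]
  have hn : (l - (μ.sheet α b : ZMod n)).val < n := ZMod.val_lt _
  rw [Finset.sum_eq_single_of_mem (l - (μ.sheet α b : ZMod n)).val (Finset.mem_range.2 hn)]
  · simp
  · intro a ha hne
    rw [if_neg]
    rintro ⟨⟨_, h⟩, _⟩
    apply hne
    rw [← h]
    push_cast
    rw [add_sub_cancel_left, ZMod.val_cast_of_lt (Finset.mem_range.1 ha)]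

theorem rotate_cover {Γ : Type*} [Ring Γ] (x : (ι × Γ) × Perm (Fin 4)) (m : ℕ) :
    (((cover α Γ).rotate^[m] x).1.1, ((cover α Γ).rotate^[m] x).2)
      = T.rotate^[m] (x.1.1, x.2) := by
  induction m with
  | zero => rfl
  | succ m ih =>
    rw [Function.iterate_succ_apply', Function.iterate_succ_apply', ← ih]
    rfl

/-- The pull back of a boundary cocycle to a cyclic cover. -/
def BoundaryCocycle.cover (β : T.BoundaryCocycle) (α : T.Cocycle) (Γ : Type*) [Ring Γ] :
    (cover α Γ).BoundaryCocycle where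
  val x v w := β.val x.1 v w
  antisymm x v w h := β.antisymm x.1 v w h
  closed x m h := by
    have h1 := β.closed (x.1.1, x.2) m (by rw [← rotate_cover (α := α) x m, h])
    simpa only [← rotate_cover (α := α) x] using h1

theorem isPeripheral_liftPow {μ : T.NormalLoop} (hμ : μ.IsPeripheral) (hα : α.eval μ = 1) :
    (μ.liftPow α n).IsPeripheral := by
  obtain ⟨⟨p, q, hper, hpos, hstep, hdisj⟩, β, hβ⟩ := hμ
  constructor
  · have hmul : ∀ f : ℕ → ℝ, (∀ k, f (k + μ.len) = f k) → ∀ m k, f (k + m * μ.len) = f k := by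
      intro f hf m
      induction m with
      | zero => simp
      | succ m ih => intro k; rw [Nat.succ_mul, ← add_assoc, hf, ih]
    have hmod : ∀ f : ℕ → ℝ, (∀ k, f (k + μ.len) = f k) → ∀ k, f (k % μ.len) = f k := by
      intro f hf k
      conv_rhs => rw [← Nat.mod_add_div k μ.len, mul_comm]
      exact (hmul f hf _ _).symm
    have harc : ∀ k, μ.arc (k % μ.len) = μ.arc k := by
      intro k
      conv_rhs => rw [← Nat.mod_add_div k μ.len, mul_comm]
      exact (μ.arc_add_mul _ _).symm
    refine ⟨p, q, fun k => ⟨hmul p (fun k => (hper k).1) n k, hmul q (fun k => (hper k).2) n k⟩,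
      hpos, hstep, fun k l hk hl hkl h1 h2 => ?_⟩
    have h1' := Prod.ext_iff.1 h1
    by_cases hmodkl : k % μ.len = l % μ.len
    · -- two lifts of the same arc lie in different sheets
      exfalso
      apply hkl
      have hs : ∀ k, μ.sheet α k = μ.sheet α (k % μ.len) + (k / μ.len : ℕ) := by
        intro k
        have := μ.sheet_add_mul α (k / μ.len) (k % μ.len)
        rwa [mul_comm (k / μ.len), Nat.mod_add_div, hα, mul_one] at this
      have h3 : ((μ.sheet α k : ℤ) : ZMod n) = (μ.sheet α l : ℤ) := h1'.2
      rw [hs k, hs l, hmodkl] at h3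
      rw [Int.cast_add, Int.cast_add, Int.cast_natCast, Int.cast_natCast] at h3
      have h4 : ((k / μ.len : ℕ) : ZMod n) = (l / μ.len : ℕ) := add_left_cancel h3
      have h5 := congrArg ZMod.val h4
      have hk' : k / μ.len < n := Nat.div_lt_of_lt_mul (by rw [mul_comm]; exact hk)
      have hl' : l / μ.len < n := Nat.div_lt_of_lt_mul (by rw [mul_comm]; exact hl)
      rw [ZMod.val_cast_of_lt hk', ZMod.val_cast_of_lt hl'] at h5
      rw [← Nat.mod_add_div k μ.len, ← Nat.mod_add_div l μ.len, hmodkl, h5]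
    · have h3 := hdisj _ _ (Nat.mod_lt k μ.len_pos) (Nat.mod_lt l μ.len_pos) hmodkl
      simp only [NormalLoop.ArcsDisjoint, NormalLoop.endDist, harc,
        hmod p fun k => (hper k).1, hmod q fun k => (hper k).2] at h3
      exact h3 h1'.1 h2
  · refine ⟨β.cover α (ZMod n), ?_⟩
    have : (β.cover α (ZMod n)).eval (μ.liftPow α n) = n * β.eval μ := by
      simp only [BoundaryCocycle.eval, NormalLoop.liftPow, BoundaryCocycle.cover]
      rw [sum_range_mul_len, Finset.mul_sum]
      refine Finset.sum_congr rfl fun b _ => ?_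
      simp [μ.arc_add_mul]
    rw [this]
    exact mul_ne_zero (by exact_mod_cast NeZero.ne n) hβ

end LiftPow

end IdealTriangulation

/-! ### Determinants of block circulant matrices -/

namespace Matrix

/-- If the rows of `M` add up to zero, then replacing any row of `M` by `c` has, up to the number of
rows, the same effect on the determinant as adding `c` to all rows. -/
theorem card_mul_det_updateRow {m R : Type*} [Fintype m] [DecidableEq m] [CommRing R]
    (M : Matrix m m R) (hM : ∀ j, ∑ i, M i j = 0) (c : m → R) (r : m) :
    Fintype.card m * (M.updateRow r c).det = (M + of fun _ j => c j).det := by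
  let A : Matrix m m R := M + of fun _ j => c j
  have h1 := det_updateRow_sum A r (fun _ => 1)
  have h2 : ∑ k, (1 : R) • A k = (Fintype.card m : R) • c := by
    ext j
    rw [Finset.sum_apply]
    simp [A, Finset.sum_add_distrib, hM]
  rw [h2, det_updateRow_smul, one_smul] at h1
  rw [show M + of (fun _ j => c j) = A from rfl, ← h1]
  congr 1
  symm
  refine det_eq_of_forall_row_eq_smul_add_const (fun i => if i = r then 0 else 1) r (by simp) ?_
  intro i j
  by_cases hi : i = r
  · subst hi; simp
  · simp [A, hi]

variable {m : Type*} [Fintype m] [DecidableEq m] (n : ℕ) [NeZero n]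

/-- The characters of `ZMod n` block diagonalize a block circulant matrix. -/
theorem det_blockCirculant (B : ZMod n → Matrix m m ℂ) :
    (of fun x y : m × ZMod n => B (y.2 - x.2) x.1 y.1).det
      = ∏ a : ZMod n, (∑ d, ZMod.stdAddChar (a * d) • B d).det := by
  let P : Matrix (m × ZMod n) (m × ZMod n) ℂ :=
    of fun x y => if x.1 = y.1 then ZMod.stdAddChar (y.2 * x.2) else 0
  let Q : Matrix (m × ZMod n) (m × ZMod n) ℂ :=
    of fun x y => if x.1 = y.1 then ZMod.stdAddChar (-(x.2 * y.2)) else 0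
  let D : ZMod n → Matrix m m ℂ := fun a => ∑ d, ZMod.stdAddChar (a * d) • B d
  have hP : IsUnit P.det := by
    have hPQ : P * Q = (n : ℂ) • (1 : Matrix (m × ZMod n) (m × ZMod n) ℂ) := by
      ext ⟨i, k⟩ ⟨j, l⟩
      rw [mul_apply, Fintype.sum_prod_type, Finset.sum_eq_single i]
      · have h1 := AddChar.sum_mulShift (k - l) (ZMod.isPrimitive_stdAddChar n)
        by_cases hij : i = j
        · subst hij
          simp only [P, Q, of_apply, if_true, ← AddChar.map_add_eq_mul]
          rw [smul_apply, one_apply, Finset.sum_congr rfl fun a _ => by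
            rw [show a * k + -(a * l) = a * (k - l) by ring], h1]
          by_cases hkl : k = l <;> simp [hkl, sub_eq_zero, ZMod.card]
        · simp [P, Q, hij]
      · intro b _ hb
        simp [P, hb.symm]
      · simp
    have h1 := congrArg det hPQ
    rw [det_mul, det_smul, det_one, mul_one] at h1
    have hn : (n : ℂ) ≠ 0 := by exact_mod_cast NeZero.ne n
    exact isUnit_of_mul_isUnit_left (y := Q.det) (by
      rw [h1]; exact (isUnit_iff_ne_zero.2 (pow_ne_zero _ hn)))
  have hMP : (of fun x y : m × ZMod n => B (y.2 - x.2) x.1 y.1) * P = P * blockDiagonal D := by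
    ext ⟨i, k⟩ ⟨j, a⟩
    have h1 : (P * blockDiagonal D) (i, k) (j, a) = ZMod.stdAddChar (a * k) * D a i j := by
      rw [mul_apply, Fintype.sum_prod_type, Finset.sum_eq_single i, Finset.sum_eq_single a]
      · simp [P, blockDiagonal_apply]
      · intro b _ hb
        simp [blockDiagonal_apply, hb]
      · simp
      · intro b _ hb
        simp [P, hb.symm]
      · simp
    rw [h1, mul_apply, Fintype.sum_prod_type, Finset.sum_eq_single j]
    · simp only [P, D, of_apply, if_true, sum_apply, smul_apply, smul_eq_mul, Finset.mul_sum]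
      refine Fintype.sum_equiv (Equiv.subRight k) _ _ fun l => ?_
      rw [Equiv.subRight_apply, ← mul_assoc, ← AddChar.map_add_eq_mul, mul_comm]
      congr 2
      ring
    · intro b _ hb
      simp [P, hb]
    · simp
  have h1 := congrArg det hMP
  rw [det_mul, det_mul, det_blockDiagonal, mul_comm] at h1
  exact hP.mul_left_cancel h1

end Matrix

/-! ### The 1-loop determinants of cyclic covers -/

namespace IdealTriangulation

open TetEdge Equiv

variable {ι : Type*} {T : IdealTriangulation ι}

/-- The row of the edge `e` in the matrix `G diag(ζ) + G' diag(ζ') + G'' diag(ζ'')`. -/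
noncomputable def gluingRow (z : ι → ℂ) (e : T.Edge) (j : ι) : ℂ :=
  ∑ q, (T.gluing q e j : ℂ) * zeta (z j) q

/-- The row of the curve `γ` in the matrix defining the 1-loop invariant. -/
noncomputable def curveRow (z : ι → ℂ) (γ : T.NormalLoop) (j : ι) : ℂ :=
  ∑ q, (γ.coeff q j : ℂ) * zeta (z j) q

theorem sum_zeta {z : ℂ} (h0 : z ≠ 0) (h1 : z ≠ 1) : ∑ q, zeta z q = 0 := by
  have h2 : 1 - z ≠ 0 := sub_ne_zero.2 h1.symm
  have h3 : z - 1 ≠ 0 := sub_ne_zero.2 h1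
  simp only [zeta, Fin.sum_univ_three, Matrix.cons_val]
  rw [← neg_sub 1 z]
  field_simp
  ring

/-- Every tetrahedron has two edges of each type, and the three logarithmic derivatives add up to
zero. -/
theorem sum_gluingRow [Fintype ι] {z : ι → ℂ} (h0 : ∀ j, z j ≠ 0) (h1 : ∀ j, z j ≠ 1)
    (e : ι ≃ T.Edge) (j : ι) : ∑ i, gluingRow z (e i) j = 0 := by
  have := Fintype.ofEquiv ι e
  simp only [gluingRow]
  rw [Finset.sum_comm]
  have h2 : ∀ q, ∑ i, (T.gluing q (e i) j : ℂ) * zeta (z j) q = 2 * zeta (z j) q := by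
    intro q
    rw [← Finset.sum_mul, e.sum_comp fun e => (T.gluing q e j : ℂ)]
    have h3 := sum_gluing_mul (fun _ : T.Edge => (1 : ℂ)) q j
    simp only [one_mul] at h3
    rw [h3]
    exact congrArg (· * _) ((quadSums_const 1 q j).trans (mul_one 2))
  rw [Finset.sum_congr rfl fun q _ => h2 q, ← Finset.mul_sum, sum_zeta (h0 j) (h1 j), mul_zero]

/-- The push forward of a flattening of the cyclic cover differs from a combination of flattenings of
the base by a solution of the homogeneous equations. -/
theorem flatteningFactor_cover_sq [Fintype ι] {α : T.Cocycle} (hT : T.IsOneCusped) (μ : T.NormalLoop)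
    (hμ : μ.IsPeripheral) (hα : α.eval μ = 1) {z : ι → ℂ} (hz : T.IsCompleteShape z)
    (n : ℕ) [NeZero n] {f g : Fin 3 → ι → ℤ} {F : Fin 3 → ι × ZMod n → ℤ}
    (hf : T.IsFlattening f) (hg : T.IsFlattening g) (hF : (cover α (ZMod n)).IsFlattening F) :
    flatteningFactor (fun j => z j.1) F ^ 2
      = (flatteningFactor z f * flatteningFactor z g ^ (n - 1)) ^ 2 := by
  have hζ : ∀ j q, zeta (z j) q ≠ 0 := fun j q => zeta_ne_zero (hz.ne_zero j) (hz.ne_one j) q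
  have hn : 1 ≤ n := Nat.one_le_iff_ne_zero.2 (NeZero.ne n)
  obtain ⟨κ, hκ⟩ := α.exists_hasJump
  let S : Fin 3 → ι → ℤ := fun q j => ∑ l : ZMod n, F q (j, l)
  have hS : flatteningFactor (fun j : ι × ZMod n => z j.1) F = flatteningFactor z S := by
    simp only [flatteningFactor, Fintype.prod_prod_type]
    refine Finset.prod_congr rfl fun j _ => ?_
    rw [Finset.prod_comm]
    exact Finset.prod_congr rfl fun q _ => prod_zpow_eq_zpow_sum _ (hζ j q) _
  have hcard : (∑ _l : ZMod n, (1 : ℤ)) = n := by simp [ZMod.card]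
  have S_tet : ∀ j, ∑ q, S q j = n := by
    intro j
    rw [Finset.sum_comm, ← hcard]
    exact Finset.sum_congr rfl fun l _ => hF.tet (j, l)
  have S_edge : ∀ e : T.Edge, ∑ q, ∑ j, (T.gluing q e j : ℤ) * S q j = 2 * n := by
    intro e
    have h1 : ∑ l : ZMod n, ∑ q, ∑ x : ι × ZMod n, ((cover α (ZMod n)).gluing q
        ((coverEdgeEquiv hκ (ZMod n)).symm (e, l)) x : ℤ) * F q x = 2 * n := by
      rw [Fintype.sum_congr _ (fun _ => (2 : ℤ)) fun l => hF.edge _]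
      simp [ZMod.card, mul_comm]
    rw [← h1]
    conv_rhs => rw [Finset.sum_comm]
    refine Finset.sum_congr rfl fun q _ => ?_
    conv_rhs => rw [Finset.sum_comm, Fintype.sum_prod_type]
    refine Finset.sum_congr rfl fun j _ => ?_
    simp only [S, Finset.mul_sum]
    refine Finset.sum_congr rfl fun l _ => ?_
    rw [← Finset.sum_mul, ← sum_cover_gluing hκ q e j l]
    push_cast
    rfl
  have S_cusp : ∑ q, ∑ j, μ.coeff q j * S q j = 0 := by
    rw [← hF.cusp _ (isPeripheral_liftPow n hμ hα)]
    refine Finset.sum_congr rfl fun q _ => ?_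
    rw [Fintype.sum_prod_type]
    refine Finset.sum_congr rfl fun j _ => ?_
    simp only [S, Finset.mul_sum, coeff_liftPow n μ hα]
  let h : Fin 3 → ι → ℤ := S - (f + ((n - 1 : ℕ) : ℤ) • g)
  have hlin : ∀ q j, h q j = S q j - (f q j + ((n : ℤ) - 1) * g q j) := by
    intro q j
    simp [h, hn]
  have h1 := flatteningFactor_sq_eq_one hT α μ hμ hα hz h (by
      intro j
      simp only [hlin, Finset.sum_sub_distrib, Finset.sum_add_distrib, ← Finset.mul_sum, S_tet,
        hf.tet, hg.tet]
      ring) (by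
      intro e
      simp only [hlin, mul_sub, mul_add, mul_left_comm _ ((n : ℤ) - 1), Finset.sum_sub_distrib,
        Finset.sum_add_distrib, ← Finset.mul_sum, S_edge, hf.edge, hg.edge]
      ring) (by
      simp only [hlin, mul_sub, mul_add, mul_left_comm _ ((n : ℤ) - 1), Finset.sum_sub_distrib,
        Finset.sum_add_distrib, ← Finset.mul_sum, S_cusp, hf.cusp μ hμ, hg.cusp μ hμ]
      ring)
  have h2 : S = h + (f + ((n - 1 : ℕ) : ℤ) • g) := by simp [h]
  rw [hS, h2, flatteningFactor_add hζ, flatteningFactor_add hζ, flatteningFactor_zsmul, mul_pow,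
    h1, one_mul, zpow_natCast]

section Det

theorem eval_twistedMatrix_apply {α : T.Cocycle} {κ : ι × TetEdge → ℤ} (hκ : T.HasJump κ α.val) (z : ι → ℂ)
    [DecidableEq T.Edge] (e : ι → (cover α ℤ).Edge) (ω : ℂˣ) (i j : ι) :
    LaurentPolynomial.eval₂ (RingHom.id ℂ) ω (twistedMatrix α z e i j)
      = ∑ q, (∑ s ∈ quad q, if T.edgeMk (j, s) = (coverEdgeEquiv hκ ℤ (e i)).1 then
          ((ω ^ (κ (j, s) + (coverEdgeEquiv hκ ℤ (e i)).2) : ℂˣ) : ℂ) else 0) * zeta (z j) q := by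
  rw [twistedMatrix, Matrix.of_apply, map_sum]
  refine Finset.sum_congr rfl fun q _ => ?_
  rw [map_mul, LaurentPolynomial.eval₂_C, RingHom.id_apply, twistedGluing_eq hκ, map_sum]
  congr 1
  refine Finset.sum_congr rfl fun s _ => ?_
  split_ifs
  · rw [LaurentPolynomial.eval₂_T]
  · rw [map_zero]

variable [Fintype ι] [DecidableEq ι]

/-- The row of the curve enters with a factor `c`, which is `n` in the block of the trivial character
of the cover. -/
theorem card_mul_det_hatMatrix {z : ι → ℂ} (h0 : ∀ j, z j ≠ 0) (h1 : ∀ j, z j ≠ 1)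
    (e : ι ≃ T.Edge) (r : ι) (γ : T.NormalLoop) (c : ℂ) :
    (c * Fintype.card ι) * (T.hatMatrix z e r γ).det
      = (Matrix.of fun i j => gluingRow z (e i) j + c * curveRow z γ j).det := by
  have h2 := Matrix.card_mul_det_updateRow (Matrix.of fun i j => gluingRow z (e i) j)
    (sum_gluingRow h0 h1 e) (c • curveRow z γ) r
  rw [Matrix.det_updateRow_smul] at h2
  rw [mul_comm c, mul_assoc]
  exact h2

theorem det_sq_eq_of_reorder {m E : Type*} [Fintype m] [DecidableEq m] (A : E → m → ℂ)
    (e e' : m ≃ E) :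
    (Matrix.of fun i j => A (e i) j).det ^ 2 = (Matrix.of fun i j => A (e' i) j).det ^ 2 := by
  have h := Matrix.det_permute (e.trans e'.symm) (Matrix.of fun i j => A (e' i) j)
  have h2 : (Matrix.of fun i j => A (e' i) j).submatrix (e.trans e'.symm) id
      = Matrix.of fun i j => A (e i) j := by
    ext i j
    simp
  rw [← h2, h, mul_pow]
  rcases Int.units_eq_one_or (Perm.sign (e.trans e'.symm)) with h | h <;> simp [h]

variable {α : T.Cocycle}

/-- The root of unity `exp (2 π i a / n)`, the value at `1` of the `a`-th character of `ZMod n`. -/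
noncomputable def charUnit (n : ℕ) [NeZero n] (a : ZMod n) : ℂˣ :=
  (rootsOfUnityCircleEquiv n (ZMod.rootsOfUnityAddChar n a)).1

theorem coe_charUnit (n : ℕ) [NeZero n] (a : ZMod n) :
    (charUnit n a : ℂ) = ZMod.stdAddChar a := by
  rw [charUnit, rootsOfUnityCircleEquiv_apply, ZMod.rootsOfUnityAddChar_val,
    ZMod.stdAddChar_apply]

theorem coe_charUnit_zpow (n : ℕ) [NeZero n] (a : ZMod n) (k : ℤ) :
    ((charUnit n a ^ k : ℂˣ) : ℂ) = ZMod.stdAddChar (a * (k : ZMod n)) := by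
  rw [Units.val_zpow_eq_zpow_val, coe_charUnit, ← AddChar.map_zsmul_eq_zpow, zsmul_eq_mul,
    mul_comm]

theorem finprod_rootsOfUnity (n : ℕ) [NeZero n] (g : ℂˣ → ℂ) :
    ∏ᶠ (ω : ℂˣ) (_ : ω ^ n = 1 ∧ ω ≠ 1), g ω
      = ∏ a ∈ (Finset.univ : Finset (ZMod n)).erase 0, g (charUnit n a) := by
  classical
  have hinj : Function.Injective (charUnit n) := fun a b h =>
    (bijective_rootsOfUnityAddChar n).1 ((rootsOfUnityCircleEquiv n).injective (Subtype.ext h))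
  have h0 : charUnit n 0 = 1 := by simp [charUnit]
  rw [← Finset.prod_image (f := g) (g := charUnit n) (fun a _ b _ h => hinj h),
    ← finprod_mem_coe_finset]
  have hS : ∀ ω : ℂˣ, (ω ^ n = 1 ∧ ω ≠ 1) ↔
      ω ∈ (((Finset.univ : Finset (ZMod n)).erase 0).image (charUnit n) : Set ℂˣ) := by
    intro ω
    refine ⟨fun h => ?_, fun h => ?_⟩
    · obtain ⟨a, ha⟩ := surjective_rootsOfUnityCircleEquiv_comp_rootsOfUnityAddChar n ⟨ω, h.1⟩
      have ha' : charUnit n a = ω := congrArg Subtype.val ha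
      refine Finset.mem_coe.2 (Finset.mem_image.2 ⟨a, Finset.mem_erase.2 ⟨?_, Finset.mem_univ _⟩,
        ha'⟩)
      rintro rfl
      exact h.2 (ha'.symm.trans h0)
    · obtain ⟨a, ha, rfl⟩ := Finset.mem_image.1 (Finset.mem_coe.1 h)
      refine ⟨(rootsOfUnityCircleEquiv n (ZMod.rootsOfUnityAddChar n a)).2,
        fun h1 => (Finset.mem_erase.1 ha).1 (hinj ?_)⟩
      rw [h1, h0]
  simp only [hS]

/-- For suitable orderings of the edges the matrix of the cyclic cover is block circulant, and so is
the matrix all of whose rows are the row of the lifted curve. -/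
theorem det_cover_eq_prod (μ : T.NormalLoop) (hα : α.eval μ = 1)
    {κ : ι × TetEdge → ℤ} (hκ : T.HasJump κ α.val) (z : ι → ℂ) (n : ℕ) [NeZero n]
    (e₀ : ι ≃ T.Edge) (e : ι → (cover α ℤ).Edge) (he : ∀ i, coverProj α ℤ (e i) = e₀ i) :
    ∃ E : ι × ZMod n ≃ (cover α (ZMod n)).Edge,
      (Matrix.of fun x y => gluingRow (fun j => z j.1) (E x) y
        + curveRow (fun j => z j.1) (μ.liftPow α n) y).det
      = (Matrix.of fun i j => gluingRow z (e₀ i) j + n * curveRow z μ j).det *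
        ∏ a ∈ (Finset.univ : Finset (ZMod n)).erase 0,
          LaurentPolynomial.eval₂ (RingHom.id ℂ) (charUnit n a) (twistedMatrix α z e).det := by
  classical
  let d : ι → ℤ := fun i => (coverEdgeEquiv hκ ℤ (e i)).2
  have hd : ∀ i, coverEdgeEquiv hκ ℤ (e i) = (e₀ i, d i) := fun i =>
    Prod.ext (by rw [← coverProj_eq, he]) rfl
  let E : ι × ZMod n ≃ (cover α (ZMod n)).Edge :=
    (Equiv.prodShear e₀ fun i => Equiv.addLeft (d i : ZMod n)).trans
      (coverEdgeEquiv hκ (ZMod n)).symm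
  have hE : ∀ x, coverEdgeEquiv hκ (ZMod n) (E x) = (e₀ x.1, (d x.1 : ZMod n) + x.2) := by
    intro x
    simp [E]
  let N : ZMod n → Fin 3 → ι → ι → ℂ := fun g q i j => ∑ s ∈ quad q,
    if T.edgeMk (j, s) = e₀ i ∧ g - (κ (j, s) : ZMod n) = d i then 1 else 0
  let B : ZMod n → Matrix ι ι ℂ := fun g =>
    Matrix.of fun i j => ∑ q, N g q i j * zeta (z j) q + curveRow z μ j
  have hB : (Matrix.of fun x y => gluingRow (fun j => z j.1) (E x) y
        + curveRow (fun j => z j.1) (μ.liftPow α n) y)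
      = Matrix.of fun x y : ι × ZMod n => B (y.2 - x.2) x.1 y.1 := by
    ext ⟨i, k⟩ ⟨j, l⟩
    simp only [Matrix.of_apply, B, gluingRow, curveRow, coeff_liftPow n μ hα, N]
    congr 1
    refine Finset.sum_congr rfl fun q _ => ?_
    rw [cover_gluing hκ, hE, Finset.card_filter]
    push_cast
    congr 1
    refine Finset.sum_congr rfl fun s _ => ?_
    refine if_congr (and_congr_right fun _ => ?_) rfl rfl
    rw [← sub_eq_zero, ← sub_eq_zero (b := (d i : ZMod n))]
    rw [show l - (κ (j, s) : ZMod n) - (d i + k) = l - k - κ (j, s) - d i by ring]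
  have hsum : ∀ a : ZMod n, ∀ i j, (∑ g, ZMod.stdAddChar (a * g) • B g) i j
      = ∑ q, (∑ s ∈ quad q, if T.edgeMk (j, s) = e₀ i then
          (((charUnit n a) ^ (κ (j, s) + d i) : ℂˣ) : ℂ) else 0) * zeta (z j) q
        + (∑ g, ZMod.stdAddChar (a * g)) * curveRow z μ j := by
    intro a i j
    simp only [Matrix.sum_apply, Matrix.smul_apply, B, Matrix.of_apply, smul_eq_mul, mul_add,
      Finset.sum_add_distrib, Finset.sum_mul]
    congr 1
    simp only [Finset.mul_sum]
    rw [Finset.sum_comm]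
    refine Finset.sum_congr rfl fun q _ => ?_
    simp only [N, Finset.sum_mul, Finset.mul_sum]
    rw [Finset.sum_comm]
    refine Finset.sum_congr rfl fun s _ => ?_
    rw [Finset.sum_eq_single ((κ (j, s) + d i : ℤ) : ZMod n), coe_charUnit_zpow]
    · by_cases h : T.edgeMk (j, s) = e₀ i <;> simp [h]
    · intro g _ hg
      have : ¬ (g - (κ (j, s) : ZMod n) = d i) := fun h => hg (by push_cast; rw [← h]; ring)
      simp [this]
    · simp
  refine ⟨E, ?_⟩
  rw [hB, Matrix.det_blockCirculant, ← Finset.mul_prod_erase _ _ (Finset.mem_univ (0 : ZMod n))]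
  congr 1
  · congr 1
    ext i j
    rw [hsum, Matrix.of_apply, gluingRow]
    congr 1
    · refine Finset.sum_congr rfl fun q _ => ?_
      rw [gluing_eq_card, Finset.card_filter]
      simp only [Nat.cast_sum, Nat.cast_ite, Nat.cast_one, Nat.cast_zero]
      congr 1
      refine Finset.sum_congr rfl fun s _ => ?_
      rw [coe_charUnit_zpow, zero_mul, AddChar.map_zero_eq_one]
    · simp [ZMod.card]
  · refine Finset.prod_congr rfl fun a ha => ?_
    rw [RingHom.map_det]
    congr 1
    ext i j
    rw [hsum, RingHom.mapMatrix_apply, Matrix.map_apply, eval_twistedMatrix_apply hκ]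
    have h1 := AddChar.sum_mulShift a (ZMod.isPrimitive_stdAddChar n)
    rw [if_neg (Finset.ne_of_mem_erase ha)] at h1
    simp only [mul_comm _ a, Nat.cast_zero] at h1
    rw [h1, zero_mul, add_zero]
    simp only [hd]

/-- The formula for the 1-loop invariant of a cyclic cover, with the sign ambiguity removed by
squaring. -/
theorem IsOneLoop.cover_sq_eq (hT : T.IsOneCusped) {μ : T.NormalLoop} (hμ : μ.IsPeripheral)
    (hα : α.eval μ = 1) {z : ι → ℂ} (hz : T.IsCompleteShape z) {n : ℕ} [NeZero n] {x y : ℂ}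
    {p : LaurentPolynomial ℂ} (hx : T.IsOneLoop z μ x)
    (hy : (cover α (ZMod n)).IsOneLoop (fun j => z j.1) (μ.liftPow α n) y)
    (hp : IsTwistedOneLoop α z p) :
    y ^ 2 = (x * ∏ᶠ (ω : ℂˣ) (_ : ω ^ n = 1 ∧ ω ≠ 1),
      LaurentPolynomial.eval₂ (RingHom.id ℂ) ω p) ^ 2 := by
  obtain ⟨e, r, f, hf, rfl⟩ := hx
  obtain ⟨e', r', F, hF, rfl⟩ := hy
  obtain ⟨e₀, lift, g, hlift, hg, rfl⟩ := hp
  obtain ⟨κ, hκ⟩ := α.exists_hasJump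
  have hζ : ∀ j q, zeta (z j) q ≠ 0 := fun j q => zeta_ne_zero (hz.ne_zero j) (hz.ne_one j) q
  have hn : (n : ℂ) ≠ 0 := by exact_mod_cast NeZero.ne n
  have hι : (Fintype.card ι : ℂ) ≠ 0 := by
    exact_mod_cast (Fintype.card_pos_iff.2 ⟨r⟩).ne'
  obtain ⟨E, hE⟩ := det_cover_eq_prod μ hα hκ z n e₀ lift hlift
  have hbase := card_mul_det_hatMatrix hz.ne_zero hz.ne_one e r μ n
  have hcover := card_mul_det_hatMatrix (z := fun j : ι × ZMod n => z j.1)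
    (fun j => hz.ne_zero j.1) (fun j => hz.ne_one j.1) e' r' (μ.liftPow α n) 1
  have hbase' := det_sq_eq_of_reorder
    (fun e j => gluingRow z e j + n * curveRow z μ j) e e₀
  have hcover' := det_sq_eq_of_reorder
    (fun e (j : ι × ZMod n) => gluingRow (fun j => z j.1) e j +
      curveRow (fun j => z j.1) (μ.liftPow α n) j) e' E
  simp only [one_mul] at hcover
  rw [← hbase] at hbase'
  rw [← hcover, hE, mul_pow _ (∏ a ∈ _, _), ← hbase', Fintype.card_prod, ZMod.card] at hcover'
  have hdet : (hatMatrix _ (fun j : ι × ZMod n => z j.1) e' r' (μ.liftPow α n)).det ^ 2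
      = (T.hatMatrix z e r μ).det ^ 2 * (∏ a ∈ (Finset.univ : Finset (ZMod n)).erase 0,
          LaurentPolynomial.eval₂ (RingHom.id ℂ) (charUnit n a)
            (twistedMatrix α z lift).det) ^ 2 := by
    push_cast at hcover'
    rw [mul_pow, mul_pow _ (T.hatMatrix z e r μ).det, mul_comm (Fintype.card ι : ℂ),
      mul_assoc] at hcover'
    exact mul_left_cancel₀ (pow_ne_zero 2 (mul_ne_zero hn hι)) hcover'
  have hflat := flatteningFactor_cover_sq hT μ hμ hα hz n hf hg hF
  have hf0 := flatteningFactor_ne_zero hζ f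
  have hg0 := flatteningFactor_ne_zero hζ g
  have hcard : ((Finset.univ : Finset (ZMod n)).erase 0).card = n - 1 := by
    rw [Finset.card_erase_of_mem (Finset.mem_univ _), Finset.card_univ, ZMod.card]
  rw [finprod_rootsOfUnity]
  simp only [map_mul, LaurentPolynomial.eval₂_C, RingHom.id_apply, Finset.prod_mul_distrib,
    Finset.prod_const, hcard]
  rw [div_pow, mul_pow 2, hdet, hflat, inv_pow]
  field_simp

end Det

end IdealTriangulation

theorem mainTheorem8 {ι : Type*} [Fintype ι] [DecidableEq ι]
    (T : IdealTriangulation ι) (hT : T.IsOneCusped)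
    (α : T.Cocycle) (μ : T.NormalLoop) (hμ : μ.IsPeripheral) (hα : α.eval μ = 1)
    (z : ι → ℂ) (hz : T.IsCompleteShape z)
    (n : ℕ) [NeZero n]
    (x y : ℂ) (p : LaurentPolynomial ℂ)
    (hx : T.IsOneLoop z μ x)
    (hy : (IdealTriangulation.cover α (ZMod n)).IsOneLoop (fun j => z j.1) (μ.liftPow α n) y)
    (hp : IdealTriangulation.IsTwistedOneLoop α z p) :
    (∃ ε : ℤˣ, y = (ε : ℤ) * (x *
      ∏ᶠ (ω : ℂˣ) (_ : ω ^ n = 1 ∧ ω ≠ 1), LaurentPolynomial.eval₂ (RingHom.id ℂ) ω p)) ∧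
    (x ≠ 0 → ∃ ε : ℤˣ, y / x = (ε : ℤ) *
      ∏ᶠ (ω : ℂˣ) (_ : ω ^ n = 1 ∧ ω ≠ 1), LaurentPolynomial.eval₂ (RingHom.id ℂ) ω p) := by
  have hsq := hx.cover_sq_eq hT hμ hα hz hy hp
  obtain ⟨ε, hε⟩ : ∃ ε : ℤˣ, y = (ε : ℤ) * (x *
      ∏ᶠ (ω : ℂˣ) (_ : ω ^ n = 1 ∧ ω ≠ 1), LaurentPolynomial.eval₂ (RingHom.id ℂ) ω p) := by
    rcases sq_eq_sq_iff_eq_or_eq_neg.1 hsq with h | h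
    · exact ⟨1, by simpa using h⟩
    · exact ⟨-1, by simpa using h⟩
  refine ⟨⟨ε, hε⟩, fun hx => ⟨ε, ?_⟩⟩
  rw [hε, div_eq_iff hx]
  ring
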